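/- Let $H=L^2(S^1)$ with orthonormal basis $e_j=z^{-j-1}$ ($j\in\mathbb Z$), and let $H_+$ and $H_-$ be the closed spans of $\{e_j\}_{j<0}$ and $\{e_j\}_{j\ge 0}$. Let $\mathrm{Gr}_{H_+}(H)$ be the set of closed subspaces $w\subset H$ whose orthogonal projection to $H_+$ is Fredholm of index zero and whose orthogonal projection to $H_-$ is Hilbert–Schmidt. The big cell consists of those $w$ for which the projection $w\to H_+$ is invertible. Let $w$ be in the big cell, and let $W=(W_+,W_-):H_+\to H_+\oplus H_-$ be an admissible frame of $w$, i.e. an injective bounded operator with image $w$ such that $W_+-1$ is of trace class. The affine coordinates of $w$ are $$A_{ab}=(W_-W_+^{-1})_{ab}=\langle e_a,\,W_-W_+^{-1}z^b\rangle ,\qquad a,b\ge 0 .$$ For $\mathbf t=(t_1,t_2,\dots)$ let $\gamma(\mathbf t)=e^{\sum_{i\ge1}t_iz^i}$, let $W_+(\mathbf t)$ be the matrix, in the basis $1,z,z^2,\dots$ of $H_+$, of the $H_+$-component of $\gamma(\mathbf t)W$, and let $$\tau_w(\mathbf t)=\det W_+(\mathbf t),$$ the determinant being the limit of the leading principal $N\times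 N$ minors as $N\to\infty$. Let the complete symmetric functions $h_j$ be given by $e^{\sum_{i\ge1}t_iz^i}=\sum_{j\ge0}h_j(\mathbf t)z^j$, and let $\partial_{\mathbf t}=\left(\tfrac1i\,\tfrac{\partial}{\partial t_i}\right)_{i\ge1}$. Then the limit defining $\tau_w(\mathbf t)$ exists for every $\mathbf t$ with $\sum_i|t_i|r^i<\infty$ for some $r>1$; as a function of any finite set of the variables $t_i$, the others being zero, $\tau_w$ is smooth (in the complex sense); $\tau_w(\mathbf 0)\ne0$; and for all $a,b\ge0$ $$A_{ab}=\frac1{\tau_w(\mathbf 0)}\sum_{j=0}^{b}h_{a+j+1}(\partial_{\mathbf t})\,h_{b-j}(-\partial_{\mathbf t})\,\tau_w(\mathbf t)\Big|_{\mathbf t=\mathbf 0} =-\frac1{\tau_w(\mathbf 0)}\sum_{j=0}^{a}h_{b+j+1}(-\partial_{\mathbf t})\,h_{a-j}(\partial_{\mathbf t})\,\tau_w(\mathbf t)\Big|_{\mathbf t=\mathbf 0}.$$ (The factor $1/\tau_w(\mathbf 0)$ disappears for frames normalised by $\det W_+=1$.) -/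

import Mathlib

open MeasureTheory Filter Topology
open scoped ContDiff

noncomputable section

namespace KPTau

/-! ### The Hilbert space and its Grassmannian -/

/-- `H = L²(S¹)`.  The circle is `ℝ / ℤ` with its normalised Haar measure and coordinate
`z = e^{2π i x}`, so that `fourierLp 2 n` is the class of the monomial `z ^ n`. -/
abbrev L2Circle : Type := Lp ℂ 2 (AddCircle.haarAddCircle (T := (1 : ℝ)))

/-- The orthonormal basis `e_j = z ^ (-j - 1)`, `j ∈ ℤ`. -/
def basisVec (j : ℤ) : L2Circle := fourierLp 2 (-j - 1)

/-- `H₊`, the closed span of the `e_j` with `j = -1, -2, …`, that is, of `1, z, z², …`. -/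
def Hplus : Submodule ℂ L2Circle :=
  (Submodule.span ℂ (Set.range fun n : ℕ => basisVec (-(n : ℤ) - 1))).topologicalClosure

/-- `H₋`, the closed span of the `e_j` with `j = 0, 1, …`, that is, of `z⁻¹, z⁻², …`. -/
def Hminus : Submodule ℂ L2Circle :=
  (Submodule.span ℂ (Set.range fun n : ℕ => basisVec (n : ℤ))).topologicalClosure

instance : CompleteSpace Hplus := Submodule.topologicalClosure.completeSpace _

instance : CompleteSpace Hminus := Submodule.topologicalClosure.completeSpace _

/-- Orthogonal projection to `H₊` (along `H₋`). -/
def projPlus : L2Circle →L[ℂ] Hplus := Hplus.orthogonalProjectionOnto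

/-- Orthogonal projection to `H₋` (along `H₊`). -/
def projMinus : L2Circle →L[ℂ] Hminus := Hminus.orthogonalProjectionOnto

/-- The monomial `z ^ n = e_{-n-1}`, `n ≥ 0`, as an element of `H₊`. -/
def monomial (n : ℕ) : Hplus :=
  ⟨basisVec (-(n : ℤ) - 1),
    Submodule.le_topologicalClosure _ (Submodule.subset_span ⟨n, rfl⟩)⟩

/-- Hilbert–Schmidt operators: `∑ ‖T bᵢ‖² < ∞` for some (equivalently, every) orthonormal basis. -/
def IsHilbertSchmidt {E F : Type} [NormedAddCommGroup E] [InnerProductSpace ℂ E]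
    [NormedAddCommGroup F] [InnerProductSpace ℂ F] (T : E →L[ℂ] F) : Prop :=
  ∃ (ι : Type) (b : HilbertBasis ι ℂ E), Summable fun i => ‖T (b i)‖ ^ 2

/-- Trace class operators: products of two Hilbert–Schmidt operators. -/
def IsTraceClass {E : Type} [NormedAddCommGroup E] [InnerProductSpace ℂ E]
    (T : E →L[ℂ] E) : Prop :=
  ∃ B C : E →L[ℂ] E, IsHilbertSchmidt B ∧ IsHilbertSchmidt C ∧ T = B ∘L C

/-- Points of the Grassmannian `Gr_{H₊}(H)` (virtual dimension zero): closed subspaces whose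
projection to `H₊` is Fredholm of index zero and whose projection to `H₋` is Hilbert–Schmidt. -/
structure InGrassmannian (w : Submodule ℂ L2Circle) : Prop where
  isClosed : IsClosed (w : Set L2Circle)
  fredholm : (projPlus ∘L w.subtypeL).IsFredholm
  index_zero : Module.finrank ℂ (projPlus ∘L w.subtypeL).ker =
    Module.finrank ℂ (Hplus ⧸ (projPlus ∘L w.subtypeL).range)
  hilbertSchmidt : IsHilbertSchmidt (projMinus ∘L w.subtypeL)

/-- The big cell: the points of the Grassmannian that project isomorphically to `H₊`. -/
structure InBigCell (w : Submodule ℂ L2Circle) : Prop extends InGrassmannian w where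
  bijective : Function.Bijective (projPlus ∘L w.subtypeL)

/-! ### Frames and affine coordinates -/

/-- The block `W₊ : H₊ → H₊` of a frame `W : H₊ → H`. -/
def plusBlock (W : Hplus →L[ℂ] L2Circle) : Hplus →L[ℂ] Hplus := projPlus ∘L W

/-- The block `W₋ : H₊ → H₋` of a frame `W : H₊ → H`. -/
def minusBlock (W : Hplus →L[ℂ] L2Circle) : Hplus →L[ℂ] Hminus := projMinus ∘L W

/-- An admissible frame of `w`: an isomorphism `W` of `H₊` onto `w` (with frame vectors
`w_j = W (z ^ j)`) such that `W₊` has a determinant, i.e. differs from the identity by a trace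
class operator. -/
structure IsAdmissibleFrame (W : Hplus →L[ℂ] L2Circle) (w : Submodule ℂ L2Circle) : Prop where
  injective : Function.Injective W
  range_eq : W.range = w
  traceClass : IsTraceClass (plusBlock W - ContinuousLinearMap.id ℂ Hplus)

/-- The affine coordinates `A_{ab} = (W₋ W₊⁻¹)_{ab}`: the `e_a`-component of
`W₋ W₊⁻¹ (z ^ b)`. -/
def affineCoord (W : Hplus →L[ℂ] L2Circle) (a b : ℕ) : ℂ :=
  inner ℂ (basisVec a)
    (((minusBlock W ∘L (plusBlock W).inverse) (monomial b) : Hminus) : L2Circle)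

/-! ### The flows and the tau function -/

/-- `γ(t) = exp (∑_{i ≥ 1} t_i z ^ i)` as a function on the circle. -/
def flow (t : ℕ+ → ℂ) (x : AddCircle (1 : ℝ)) : ℂ :=
  Complex.exp (∑' i : ℕ+, t i * fourier (i : ℤ) x)

/-- Flow parameters for which `γ(t)` is analytic on a neighbourhood of the closed unit disc. -/
def FlowParam (t : ℕ+ → ℂ) : Prop :=
  ∃ r : ℝ, 1 < r ∧ Summable fun i : ℕ+ => ‖t i‖ * r ^ (i : ℕ)

/-- The matrix `W(t)` of homogeneous coordinates of `γ(t) w`: its `(i, j)` entry is the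
component along `e_i = z ^ (-i - 1)` of `γ(t) w_j`. -/
def homogCoord (W : Hplus →L[ℂ] L2Circle) (t : ℕ+ → ℂ) : Matrix ℤ ℕ ℂ :=
  Matrix.of fun i j =>
    fourierCoeff (fun x : AddCircle (1 : ℝ) => flow t x * (W (monomial j)) x) (-i - 1)

/-- The block `W₊(t)`, with rows `-1, -2, …` of `W(t)`. -/
def flowPlusBlock (W : Hplus →L[ℂ] L2Circle) (t : ℕ+ → ℂ) : Matrix ℕ ℕ ℂ :=
  (homogCoord W t).submatrix (fun i : ℕ => -(i : ℤ) - 1) id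

/-- The leading `N × N` principal minor. -/
def leadingMinor (M : Matrix ℕ ℕ ℂ) (N : ℕ) : ℂ :=
  (M.submatrix (fun i : Fin N => (i : ℕ)) (fun i : Fin N => (i : ℕ))).det

/-- The determinant of a semi-infinite matrix, as the limit of its leading principal minors.
For `1 + trace class` this is the Fredholm determinant. -/
def infDet (M : Matrix ℕ ℕ ℂ) : ℂ := limUnder atTop (leadingMinor M)

/-- The KP tau function `τ_w(t) = det W₊(t)`. -/
def tau (W : Hplus →L[ℂ] L2Circle) (t : ℕ+ → ℂ) : ℂ := infDet (flowPlusBlock W t)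

/-! ### Complete symmetric functions as differential operators -/

/-- The complete symmetric functions in the flow variables, given by
`exp (∑_{i ≥ 1} t_i z ^ i) = ∑_j h_j(t) z ^ j`. -/
def completeSymm (k : ℕ) : MvPolynomial ℕ+ ℂ :=
  PowerSeries.coeff k
    ((PowerSeries.exp (MvPolynomial ℕ+ ℂ)).subst
      (PowerSeries.mk fun n : ℕ =>
        if hn : 0 < n then (MvPolynomial.X (n.toPNat hn) : MvPolynomial ℕ+ ℂ) else 0))

/-- The operator `(ε / i) ∂/∂t_i`. -/
def scaledPartial (ε : ℂ) (i : ℕ+) (f : (ℕ+ → ℂ) → ℂ) : (ℕ+ → ℂ) → ℂ :=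
  fun t => ε / ((i : ℕ) : ℂ) * lineDeriv ℂ f t (Pi.single i 1)

/-- The operator `∏_i ((ε / i) ∂/∂t_i) ^ (m i)`. -/
def scaledPartialMonomial (ε : ℂ) (m : ℕ+ →₀ ℕ) (f : (ℕ+ → ℂ) → ℂ) : (ℕ+ → ℂ) → ℂ :=
  (m.support.sort (· ≤ ·)).foldr (fun i g => (scaledPartial ε i)^[m i] g) f

/-- The differential operator `p(ε ∂_t)`, where `∂_t = (∂/∂t_1, (1/2) ∂/∂t_2, (1/3) ∂/∂t_3, …)`. -/
def diffOp (ε : ℂ) (p : MvPolynomial ℕ+ ℂ) (f : (ℕ+ → ℂ) → ℂ) : (ℕ+ → ℂ) → ℂ :=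
  fun t => ∑ m ∈ p.support, p.coeff m * scaledPartialMonomial ε m f t

end KPTau

end

/-!
The determinant along the flow is reduced to an honest Fredholm determinant. Multiplying `W₊(t)`
on the left by the unipotent lower triangular Toeplitz matrix `a⁻¹` of `γ(-t)` leaves every
leading minor unchanged and produces `W₊ + a⁻¹ b W₋`, where `a : H₊ → H₊` and `b : H₋ → H₊` are
the blocks of multiplication by `γ(t)` (`FlowNormLE.leadingMinor_flowPlusBlock`). This matrix is
the identity plus a matrix `A` with `|A i j| ≤ β i * κ j` for square-summable `β` and `κ`. For
such matrices the determinant is estimated through the inequality `λ ≤ exp (λ - 1)` for the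
eigenvalues of `Mᴴ * M` (`norm_det_sq_le`), and the Schwarz lemma turns that bound into a
Lipschitz estimate (`norm_det_sub_det_le`). Hence the leading minors converge
(`Dominated.tendsto_infDet`), uniformly on bounded sets of flow parameters, so that the tau
function is smooth in finitely many variables (`IsAdmissibleFrame.contDiff_tau`), and it is
locally Lipschitz in a weighted `ℓ¹` norm (`IsAdmissibleFrame.exists_norm_tau_sub_le`).
Multiplicativity of the determinant gives `τ(0) ≠ 0` (`IsAdmissibleFrame.infDet_plus_ne_zero`).

For `t_i = (x ^ i - y ^ i) / i` one has `γ(t) = (1 - y z) / (1 - x z)`, and the matrix of `a⁻¹ b`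
has the rank one entries `(x - y) y ^ i x ^ l`. The determinant of a rank one perturbation is
explicit: `τ(t) = τ(0) (1 + (x - y) ∑ A_{ab} x ^ a y ^ b)` (`IsAdmissibleFrame.tau_twoPointFlow`).

On the other side, Newton's recursion for the complete symmetric functions shows that
`∑ h_k(ε ∂_t) x ^ k` is the translation of `t` by `ε (x, x² / 2, x³ / 3, …)`, as an
identity of Taylor coefficients when only finitely many variables are moved
(`diffOp_completeSymm_eq_taylorCoeff`).
Therefore `h_m(∂_t) h_n(-∂_t) τ` at `0` is the coefficient of `x ^ m y ^ n` in `τ` at the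
two-point flow truncated after `K ≥ m + n` variables; by the Lipschitz estimate the truncation is
an error of order `K + 1`, invisible to this coefficient (`taylorCoeff_taylorCoeff_eq_zero`). So
`h_m(∂_t) h_n(-∂_t) τ (0)` is `τ(0)` times the coefficient of `x ^ m y ^ n` in
`1 + (x - y) ∑ A_{ab} x ^ a y ^ b`. Dividing by `x - y` amounts to summing along
antidiagonals, from either end, which gives the two formulas for `A_{ab}`.
-/

namespace KPTau

/-! ### Determinants of matrices dominated by a product of square-summable sequences -/

/-- Bound for `|det (1 + A)|` when `|A i j| ≤ β i * κ j`, `∑ β² ≤ S` and `∑ κ² ≤ K`. -/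
noncomputable def detBound (S K : ℝ) : ℝ := Real.exp ((S + K + S * K) / 2)

theorem detBound_pos (S K : ℝ) : 0 < detBound S K := Real.exp_pos _

open scoped ComplexOrder in
/-- If `λ` runs over the eigenvalues of `Mᴴ * M`, then `|det M|² = ∏ λ ≤ ∏ exp (λ - 1)`. -/
theorem norm_det_sq_le {ι : Type*} [Fintype ι] [DecidableEq ι] (M : Matrix ι ι ℂ) :
    ‖M.det‖ ^ 2 ≤ Real.exp ((∑ i, ∑ j, ‖M i j‖ ^ 2) - Fintype.card ι) := by
  have hP := Matrix.posSemidef_conjTranspose_mul_self M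
  have hH := hP.isHermitian
  have hdet : ((‖M.det‖ ^ 2 : ℝ) : ℂ) = ((∏ i, hH.eigenvalues i : ℝ) : ℂ) := by
    have h := hH.det_eq_prod_eigenvalues
    rw [Matrix.det_mul, Matrix.det_conjTranspose] at h
    push_cast
    rw [← Complex.conj_mul']
    simpa using h
  have htr : ((∑ i, ∑ j, ‖M i j‖ ^ 2 : ℝ) : ℂ) = ((∑ i, hH.eigenvalues i : ℝ) : ℂ) := by
    have h := hH.trace_eq_sum_eigenvalues
    rw [Matrix.trace] at h
    push_cast
    rw [Finset.sum_comm]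
    simp only [Matrix.diag_apply, Matrix.mul_apply, Matrix.conjTranspose_apply] at h
    simp only [← Complex.conj_mul']
    simpa using h
  have hdet' := Complex.ofReal_injective hdet
  have htr' := Complex.ofReal_injective htr
  rw [hdet', htr', ← Finset.card_univ, Finset.card_eq_sum_ones]
  push_cast
  rw [← Finset.sum_sub_distrib, Real.exp_sum]
  refine Finset.prod_le_prod (fun i _ => hP.eigenvalues_nonneg i) fun i _ => ?_
  have := Real.add_one_le_exp (hH.eigenvalues i - 1)
  linarith

theorem norm_det_one_add_le {ι : Type*} [Fintype ι] [DecidableEq ι] {A : Matrix ι ι ℂ}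
    {β κ : ι → ℝ} {S K : ℝ} (hA : ∀ i j, ‖A i j‖ ≤ β i * κ j) (hS : ∑ i, β i ^ 2 ≤ S)
    (hK : ∑ i, κ i ^ 2 ≤ K) :
    ‖(1 + A).det‖ ≤ detBound S K := by
  have hexp : ∀ i j, ‖(1 + A) i j‖ ^ 2 ≤
      (if i = j then 1 + β i ^ 2 + κ i ^ 2 else 0) + β i ^ 2 * κ j ^ 2 := by
    intro i j
    rw [Matrix.add_apply, Matrix.one_apply]
    have h1 := hA i j
    have h0 := norm_nonneg (A i j)
    have h3 : ‖A i j‖ ^ 2 ≤ β i ^ 2 * κ j ^ 2 := by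
      rw [← mul_pow]; gcongr
    split_ifs with h
    · subst h
      have h2 : ‖1 + A i i‖ ≤ 1 + ‖A i i‖ := (norm_add_le _ _).trans (by simp)
      have : ‖1 + A i i‖ ^ 2 ≤ (1 + ‖A i i‖) ^ 2 := by gcongr
      nlinarith [sq_nonneg (β i - κ i)]
    · simpa using h3
  have hsum : (∑ i, ∑ j, ‖(1 + A) i j‖ ^ 2) - Fintype.card ι ≤ S + K + S * K := by
    have h1 : (∑ i, ∑ j, ‖(1 + A) i j‖ ^ 2) ≤
        Fintype.card ι + ∑ i, β i ^ 2 + ∑ i, κ i ^ 2 + (∑ i, β i ^ 2) * ∑ i, κ i ^ 2 := by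
      refine (Finset.sum_le_sum fun i _ => Finset.sum_le_sum fun j _ => hexp i j).trans ?_
      simp only [Finset.sum_add_distrib, Finset.sum_ite_eq, Finset.mem_univ, if_true,
        Finset.sum_mul_sum]
      simp
    have h2 : 0 ≤ ∑ i, β i ^ 2 := Finset.sum_nonneg fun i _ => sq_nonneg _
    have h3 : 0 ≤ ∑ i, κ i ^ 2 := Finset.sum_nonneg fun i _ => sq_nonneg _
    nlinarith [mul_le_mul hS hK h3 (h2.trans hS)]
  have h := (norm_det_sq_le (1 + A)).trans (Real.exp_le_exp.2 hsum)
  refine le_of_sq_le_sq ?_ (detBound_pos S K).le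
  rw [detBound, ← Real.exp_nat_mul]
  convert h using 2
  push_cast
  ring

theorem differentiable_det {ι : Type*} [Fintype ι] [DecidableEq ι] {M : ℂ → Matrix ι ι ℂ}
    (hM : ∀ i j, Differentiable ℂ fun z => M z i j) : Differentiable ℂ fun z => (M z).det := by
  simp only [Matrix.det_apply]
  fun_prop

/-- Lipschitz estimate: the Schwarz lemma applied to `z ↦ det (1 + A + z (A' - A))` on the disc of
radius `1 / δ`. -/
theorem norm_det_sub_det_le {ι : Type*} [Fintype ι] [DecidableEq ι] {A A' : Matrix ι ι ℂ}
    {β κ κ' : ι → ℝ} {S K K' δ : ℝ} (hA : ∀ i j, ‖A i j‖ ≤ β i * κ j)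
    (hδ : 0 < δ) (hδ1 : δ < 1) (hA' : ∀ i j, ‖A' i j - A i j‖ ≤ δ * (β i * κ' j))
    (hS : ∑ i, β i ^ 2 ≤ S) (hK : ∑ i, κ i ^ 2 ≤ K) (hK' : ∑ i, κ' i ^ 2 ≤ K') :
    ‖(1 + A').det - (1 + A).det‖ ≤ 2 * δ * detBound S (2 * K + 2 * K') := by
  set g : ℂ → ℂ := fun z => (1 + (A + z • (A' - A))).det with hg
  have hgd : Differentiable ℂ g := by
    apply differentiable_det
    intro i j
    simp only [Matrix.add_apply, Matrix.smul_apply, smul_eq_mul]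
    fun_prop
  have hb : ∀ z : ℂ, ‖z‖ ≤ 1 / δ → ‖g z‖ ≤ detBound S (2 * K + 2 * K') := by
    intro z hz
    refine norm_det_one_add_le (κ := fun j => κ j + κ' j) (fun i j => ?_) hS ?_
    · rw [Matrix.add_apply, Matrix.smul_apply, Matrix.sub_apply, smul_eq_mul, mul_add]
      refine (norm_add_le _ _).trans (add_le_add (hA i j) ?_)
      rw [norm_mul]
      calc ‖z‖ * ‖A' i j - A i j‖ ≤ 1 / δ * (δ * (β i * κ' j)) := by
            gcongr; exact hA' i j
        _ = β i * κ' j := by field_simp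
    · calc ∑ i, (κ i + κ' i) ^ 2 ≤ ∑ i, (2 * κ i ^ 2 + 2 * κ' i ^ 2) :=
            Finset.sum_le_sum fun i _ => by nlinarith [sq_nonneg (κ i - κ' i)]
        _ ≤ _ := by
            rw [Finset.sum_add_distrib, ← Finset.mul_sum, ← Finset.mul_sum]; gcongr
  have h := Complex.dist_le_div_mul_dist_of_mapsTo_ball (f := g) (c := 0) (z := 1) (R₁ := 1 / δ)
    (R₂ := 2 * detBound S (2 * K + 2 * K')) hgd.differentiableOn
    (fun z hz => by
      rw [mem_ball_zero_iff] at hz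
      rw [Metric.mem_closedBall, dist_eq_norm]
      refine (norm_sub_le _ _).trans ?_
      have h0 : ‖g 0‖ ≤ detBound S (2 * K + 2 * K') := hb 0 (by simp [hδ.le])
      linarith [hb z hz.le])
    (by rw [mem_ball_zero_iff, norm_one]; exact (one_lt_div hδ).2 hδ1)
  rw [dist_eq_norm] at h
  simp only [hg, one_smul, zero_smul, add_zero, add_sub_cancel, dist_zero_right, norm_one,
    mul_one] at h
  refine h.trans (le_of_eq ?_)
  field_simp

/-! ### Fredholm determinants -/

/-- `|A i j| ≤ β i * κ j` with `β` and `κ` square-summable; matrices of trace class operators, being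
products of Hilbert–Schmidt operators, are of this form. -/
structure Dominated (A : Matrix ℕ ℕ ℂ) (β κ : ℕ → ℝ) : Prop where
  left_nonneg : ∀ i, 0 ≤ β i
  right_nonneg : ∀ i, 0 ≤ κ i
  left_summable : Summable fun i => β i ^ 2
  right_summable : Summable fun i => κ i ^ 2
  bound : ∀ i j, ‖A i j‖ ≤ β i * κ j

theorem leadingMinor_succ_of_last_column {M : Matrix ℕ ℕ ℂ} {n : ℕ}
    (h : ∀ i < n, M i n = 0) (h1 : M n n = 1) : leadingMinor M (n + 1) = leadingMinor M n := by
  rw [leadingMinor, Matrix.det_succ_column _ (Fin.last n), Finset.sum_eq_single (Fin.last n)]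
  · simp [h1, leadingMinor, Matrix.submatrix_submatrix, Function.comp_def,
      Even.neg_one_pow ⟨n, rfl⟩]
  · intro i _ hi
    have : (i : ℕ) < n := Fin.val_lt_last hi
    simp [h _ this]
  · simp

theorem leadingMinor_congr {M M' : Matrix ℕ ℕ ℂ} {n : ℕ}
    (h : ∀ i < n, ∀ j < n, M i j = M' i j) : leadingMinor M n = leadingMinor M' n := by
  rw [leadingMinor, leadingMinor]
  congr 1
  ext i j
  exact h i i.2 j j.2

/-- The `N`-th leading minor of `1 + A` is the `N'`-th one of `1 + A` with the columns from `N` on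
removed from `A`. -/
theorem leadingMinor_truncate (A : Matrix ℕ ℕ ℂ) {N N' : ℕ} (h : N ≤ N') :
    leadingMinor (1 + Matrix.of fun i j => if j < N then A i j else 0) N' =
      leadingMinor (1 + A) N := by
  induction N', h using Nat.le_induction with
  | base =>
    refine leadingMinor_congr fun i hi j hj => ?_
    simp [hj]
  | succ n hn ih =>
    rw [leadingMinor_succ_of_last_column, ih]
    · intro i hi
      simp [hi.ne, hn]
    · simp [hn]

theorem leadingMinor_one_add (A : Matrix ℕ ℕ ℂ) (N : ℕ) :
    leadingMinor (1 + A) N =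
      (1 + A.submatrix (fun i : Fin N => (i : ℕ)) (fun i : Fin N => (i : ℕ))).det := by
  rw [leadingMinor]
  congr 1
  ext i j
  simp [Matrix.one_apply, Fin.ext_iff]

theorem sum_fin_le_of_summable {f : ℕ → ℝ} (hf : Summable f) (h0 : ∀ i, 0 ≤ f i) (N : ℕ) :
    ∑ i : Fin N, f i ≤ ∑' i, f i := by
  rw [Fin.sum_univ_eq_sum_range]
  exact hf.sum_le_tsum _ fun i _ => h0 i

theorem norm_leadingMinor_sub_le {A A' : Matrix ℕ ℕ ℂ} {β κ κ' : ℕ → ℝ} {S K K' δ : ℝ} {N : ℕ}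
    (hA : ∀ i < N, ∀ j < N, ‖A i j‖ ≤ β i * κ j)
    (hδ : 0 < δ) (hδ1 : δ < 1)
    (hA' : ∀ i < N, ∀ j < N, ‖A' i j - A i j‖ ≤ δ * (β i * κ' j))
    (hS : ∑ i : Fin N, β i ^ 2 ≤ S) (hK : ∑ i : Fin N, κ i ^ 2 ≤ K)
    (hK' : ∑ i : Fin N, κ' i ^ 2 ≤ K') :
    ‖leadingMinor (1 + A') N - leadingMinor (1 + A) N‖ ≤ 2 * δ * detBound S (2 * K + 2 * K') := by
  rw [leadingMinor_one_add, leadingMinor_one_add]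
  exact norm_det_sub_det_le (β := fun i : Fin N => β i) (κ := fun i : Fin N => κ i)
    (κ' := fun i : Fin N => κ' i) (fun i j => hA i i.2 j j.2) hδ hδ1
    (fun i j => hA' i i.2 j j.2) hS hK hK'

/-- Two leading minors of `1 + A` differ by at most the tail of `κ`, uniformly in the matrices `A`
dominated by `β` and `κ` with `∑ β² ≤ S`. -/
theorem norm_leadingMinor_sub_le_tail {A : Matrix ℕ ℕ ℂ} {β κ : ℕ → ℝ} (hA : Dominated A β κ)
    {S δ : ℝ} (hS : ∑' i, β i ^ 2 ≤ S) (hδ : 0 < δ) (hδ1 : δ < 1) {N N' : ℕ} (hN : N ≤ N')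
    (htail : ∑' j, κ (j + N) ^ 2 ≤ δ ^ 2) :
    ‖leadingMinor (1 + A) N' - leadingMinor (1 + A) N‖ ≤
      2 * δ * detBound S (2 * (∑' j, κ j ^ 2) + 2) := by
  rw [← leadingMinor_truncate A hN]
  have hβ2 := (sum_fin_le_of_summable hA.left_summable (fun i => sq_nonneg _) N').trans hS
  have hκ2 := sum_fin_le_of_summable hA.right_summable (fun i => sq_nonneg _) N'
  have := norm_leadingMinor_sub_le (N := N')
    (A := Matrix.of fun i j => if j < N then A i j else 0) (A' := A) (β := β) (κ := κ)
    (κ' := fun j => if j < N then 0 else κ j / δ) (K' := 1)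
    (fun i _ j _ => ?_) hδ hδ1 (fun i _ j _ => ?_)
    hβ2 hκ2 ?_
  · simpa using this
  · have := hA.bound i j
    simp only [Matrix.of_apply]
    split_ifs
    exacts [this, by simpa using (norm_nonneg _).trans this]
  · simp only [Matrix.of_apply]
    split_ifs
    · simp
    · have := hA.bound i j
      rw [sub_zero]
      refine this.trans (le_of_eq ?_)
      field_simp
  · rw [Fin.sum_univ_eq_sum_range (fun j => (if j < N then 0 else κ j / δ) ^ 2)]
    obtain ⟨d, rfl⟩ := Nat.exists_eq_add_of_le hN
    rw [Finset.sum_range_add, Finset.sum_eq_zero, zero_add]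
    · have h1 : ∑ x ∈ Finset.range d, κ (x + N) ^ 2 ≤ δ ^ 2 :=
        (((summable_nat_add_iff N).2 hA.right_summable).sum_le_tsum _
          (fun i _ => sq_nonneg _)).trans htail
      have h2 : ∀ x, (if N + x < N then 0 else κ (N + x) / δ) ^ 2 = κ (x + N) ^ 2 / δ ^ 2 := by
        intro x
        rw [if_neg (by omega), div_pow, add_comm]
      simp only [h2]
      rw [← Finset.sum_div]
      exact (div_le_one (by positivity)).2 h1
    · intro j hj
      rw [if_pos (Finset.mem_range.1 hj)]
      simp

theorem tendsto_tail_zero {κ : ℕ → ℝ} :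
    Tendsto (fun N => ∑' j, κ (j + N) ^ 2) atTop (𝓝 0) :=
  tendsto_sum_nat_add fun j => κ j ^ 2

/-- The leading minors of `1 + A` are Cauchy, uniformly in the matrices `A` dominated by a fixed `κ`
and some `β` with `∑ β² ≤ S`. -/
theorem exists_forall_norm_leadingMinor_sub_lt (κ : ℕ → ℝ) (S : ℝ) {ε : ℝ} (hε : 0 < ε) :
    ∃ N₀ : ℕ, ∀ (A : Matrix ℕ ℕ ℂ) (β : ℕ → ℝ), Dominated A β κ → ∑' i, β i ^ 2 ≤ S →
      ∀ N ≥ N₀, ∀ N' ≥ N₀, ‖leadingMinor (1 + A) N' - leadingMinor (1 + A) N‖ < ε := by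
  set Φ := detBound S (2 * (∑' j, κ j ^ 2) + 2) with hΦ
  have hΦ0 : 0 < Φ := detBound_pos _ _
  set δ := min (1 / 2) (ε / (8 * Φ)) with hδd
  have hδ : 0 < δ := by positivity
  have hδ1 : δ < 1 := (min_le_left _ _).trans_lt (by norm_num)
  have hδε : 2 * δ * Φ < ε / 2 := by
    have : δ ≤ ε / (8 * Φ) := min_le_right _ _
    rw [le_div_iff₀ (by positivity)] at this
    nlinarith
  obtain ⟨N₀, hN₀⟩ := ((tendsto_tail_zero (κ := κ)).eventually
    (gt_mem_nhds (show (0 : ℝ) < δ ^ 2 by positivity))).exists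
  refine ⟨N₀, fun A β hA hS N hN N' hN' => ?_⟩
  have h1 := norm_leadingMinor_sub_le_tail hA hS hδ hδ1 hN hN₀.le
  have h2 := norm_leadingMinor_sub_le_tail hA hS hδ hδ1 hN' hN₀.le
  rw [← hΦ] at h1 h2
  calc _ = ‖(leadingMinor (1 + A) N' - leadingMinor (1 + A) N₀) -
        (leadingMinor (1 + A) N - leadingMinor (1 + A) N₀)‖ := by congr 1; ring
    _ ≤ _ := norm_sub_le _ _
    _ < ε := by linarith

theorem Dominated.tendsto_infDet {A : Matrix ℕ ℕ ℂ} {β κ : ℕ → ℝ} (hA : Dominated A β κ) :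
    Tendsto (leadingMinor (1 + A)) atTop (𝓝 (infDet (1 + A))) := by
  refine CauchySeq.tendsto_limUnder (Metric.cauchySeq_iff.2 fun ε hε => ?_)
  obtain ⟨N₀, h⟩ := exists_forall_norm_leadingMinor_sub_lt κ (∑' i, β i ^ 2) hε
  exact ⟨N₀, fun m hm n hn => by rw [dist_eq_norm]; exact h A β hA le_rfl n hn m hm⟩

theorem Dominated.norm_infDet_sub_le {A A' : Matrix ℕ ℕ ℂ} {β κ β' κ' : ℕ → ℝ}
    (hA : Dominated A β κ) (hA' : Dominated A' β' κ') {δ : ℝ} (hδ : 0 < δ) (hδ1 : δ < 1)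
    (h : ∀ i j, ‖A' i j - A i j‖ ≤ δ * (β i * κ j)) :
    ‖infDet (1 + A') - infDet (1 + A)‖ ≤
      2 * δ * detBound (∑' i, β i ^ 2) (2 * (∑' i, κ i ^ 2) + 2 * (∑' i, κ i ^ 2)) := by
  refine le_of_tendsto ((hA'.tendsto_infDet.sub hA.tendsto_infDet).norm) (.of_forall fun N => ?_)
  exact norm_leadingMinor_sub_le
    (fun i _ j _ => hA.bound i j) hδ hδ1 (fun i _ j _ => h i j)
    (sum_fin_le_of_summable hA.left_summable (fun i => sq_nonneg _) N)
    (sum_fin_le_of_summable hA.right_summable (fun i => sq_nonneg _) N)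
    (sum_fin_le_of_summable hA.right_summable (fun i => sq_nonneg _) N)

theorem summable_mul_of_summable_sq {f g : ℕ → ℝ} (hf : Summable fun i => f i ^ 2)
    (hg : Summable fun i => g i ^ 2) : Summable fun i => f i * g i := by
  refine Summable.of_norm_bounded (hf.add hg) fun i => ?_
  rw [Real.norm_eq_abs, abs_mul, ← sq_abs (f i), ← sq_abs (g i)]
  nlinarith [sq_nonneg (|f i| - |g i|), abs_nonneg (f i), abs_nonneg (g i)]

theorem summable_add_sq {f g : ℕ → ℝ} (hf : Summable fun i => f i ^ 2)
    (hg : Summable fun i => g i ^ 2) : Summable fun i => (f i + g i) ^ 2 := by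
  have := (hf.add hg).add ((summable_mul_of_summable_sq hf hg).mul_left 2)
  exact this.congr fun i => by ring

theorem Dominated.add {A A' : Matrix ℕ ℕ ℂ} {β κ β' κ' : ℕ → ℝ}
    (hA : Dominated A β κ) (hA' : Dominated A' β' κ') :
    Dominated (A + A') (fun i => β i + β' i) (fun j => κ j + κ' j) where
  left_nonneg i := add_nonneg (hA.left_nonneg i) (hA'.left_nonneg i)
  right_nonneg i := add_nonneg (hA.right_nonneg i) (hA'.right_nonneg i)
  left_summable := summable_add_sq hA.left_summable hA'.left_summable
  right_summable := summable_add_sq hA.right_summable hA'.right_summable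
  bound i j := by
    rw [Matrix.add_apply]
    refine (norm_add_le _ _).trans ((add_le_add (hA.bound i j) (hA'.bound i j)).trans ?_)
    nlinarith [mul_nonneg (hA.left_nonneg i) (hA'.right_nonneg j),
      mul_nonneg (hA'.left_nonneg i) (hA.right_nonneg j)]

/-- The product of two infinite matrices. -/
noncomputable def infMul (S T : Matrix ℕ ℕ ℂ) : Matrix ℕ ℕ ℂ :=
  Matrix.of fun i j => ∑' k, S i k * T k j

theorem Dominated.summable_mul {S T : Matrix ℕ ℕ ℂ} {β κ β' κ' : ℕ → ℝ}
    (hS : Dominated S β κ) (hT : Dominated T β' κ') (i j : ℕ) :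
    Summable fun k => S i k * T k j := by
  refine Summable.of_norm_bounded (((summable_mul_of_summable_sq hS.right_summable
    hT.left_summable).mul_left (β i * κ' j))) fun k => ?_
  rw [norm_mul]
  calc _ ≤ (β i * κ k) * (β' k * κ' j) := mul_le_mul (hS.bound i k) (hT.bound k j)
        (norm_nonneg _) (mul_nonneg (hS.left_nonneg i) (hS.right_nonneg k))
    _ = _ := by ring

theorem Dominated.norm_tsum_mul_le {S T : Matrix ℕ ℕ ℂ} {β κ β' κ' : ℕ → ℝ}
    (hS : Dominated S β κ) (hT : Dominated T β' κ') (i j N : ℕ) :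
    ‖∑' k, S i (k + N) * T (k + N) j‖ ≤ (∑' k, κ (k + N) * β' (k + N)) * (β i * κ' j) := by
  have hsum := (summable_nat_add_iff N).2
    (summable_mul_of_summable_sq hS.right_summable hT.left_summable)
  rw [mul_comm]
  rw [← tsum_mul_left]
  refine tsum_of_norm_bounded (hsum.mul_left _).hasSum fun k => ?_
  rw [norm_mul]
  calc _ ≤ (β i * κ (k + N)) * (β' (k + N) * κ' j) := mul_le_mul (hS.bound i _) (hT.bound _ j)
        (norm_nonneg _) (mul_nonneg (hS.left_nonneg i) (hS.right_nonneg _))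
    _ = _ := by ring

theorem Dominated.infMul {S T : Matrix ℕ ℕ ℂ} {β κ β' κ' : ℕ → ℝ}
    (hS : Dominated S β κ) (hT : Dominated T β' κ') :
    Dominated (infMul S T) β (fun j => (∑' k, κ k * β' k) * κ' j) where
  left_nonneg := hS.left_nonneg
  right_nonneg j := mul_nonneg (tsum_nonneg fun k =>
    mul_nonneg (hS.right_nonneg k) (hT.left_nonneg k)) (hT.right_nonneg j)
  left_summable := hS.left_summable
  right_summable := by
    simp only [mul_pow]
    exact hT.right_summable.mul_left _
  bound i j := by
    refine (hS.norm_tsum_mul_le hT i j 0).trans (le_of_eq ?_)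
    simp only [add_zero]
    ring

/-- The Fredholm determinant is multiplicative.  The truncation of the product differs from the
product of the truncations by the tail of the sums over the inner index. -/
theorem Dominated.infDet_mul {S T : Matrix ℕ ℕ ℂ} {β κ β' κ' : ℕ → ℝ}
    (hS : Dominated S β κ) (hT : Dominated T β' κ') :
    infDet (1 + (S + T + KPTau.infMul S T)) = infDet (1 + S) * infDet (1 + T) := by
  have hP := (hS.add hT).add (hS.infMul hT)
  have h1 := hP.tendsto_infDet
  have h2 := hS.tendsto_infDet.mul hT.tendsto_infDet
  set b : ℕ → ℝ := fun i => β i + β' i + β i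
  set c : ℕ → ℝ := fun j => κ j + κ' j + (∑' k, κ k * β' k) * κ' j
  set Φ := detBound (∑' i, b i ^ 2)
    (2 * (∑' i, c i ^ 2) + 2 * (∑' i, κ' i ^ 2)) with hΦ
  have hsumm := summable_mul_of_summable_sq hS.right_summable hT.left_summable
  have htail : Tendsto (fun N => ∑' k, κ (k + N) * β' (k + N)) atTop (𝓝 0) :=
    tendsto_sum_nat_add fun k => κ k * β' k
  have hnn : ∀ N, 0 ≤ ∑' k, κ (k + N) * β' (k + N) := fun N => tsum_nonneg fun k =>
    mul_nonneg (hS.right_nonneg _) (hT.left_nonneg _)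
  have hlim : Tendsto (fun N => leadingMinor (1 + S) N * leadingMinor (1 + T) N -
      leadingMinor (1 + (S + T + KPTau.infMul S T)) N) atTop (𝓝 0) := by
    -- The quantity `1 / (N + 1)` is added to make the Lipschitz constant positive.
    have hδ : Tendsto (fun N : ℕ => (∑' k, κ (k + N) * β' (k + N)) + 1 / ((N : ℝ) + 1))
        atTop (𝓝 0) := by
      simpa using htail.add tendsto_one_div_add_atTop_nhds_zero_nat
    have hbd : Tendsto (fun N : ℕ => 2 * ((∑' k, κ (k + N) * β' (k + N)) + 1 / ((N : ℝ) + 1)) * Φ)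
        atTop (𝓝 0) := by
      simpa using (hδ.const_mul 2).mul_const Φ
    refine squeeze_zero_norm' ?_ hbd
    filter_upwards [hδ.eventually (gt_mem_nhds zero_lt_one)] with N hN
    have hpos : 0 < (∑' k, κ (k + N) * β' (k + N)) + 1 / ((N : ℝ) + 1) :=
      add_pos_of_nonneg_of_pos (hnn N) (by positivity)
    have hprod : leadingMinor (1 + S) N * leadingMinor (1 + T) N =
        leadingMinor (1 + Matrix.of fun i j => S i j + T i j +
          ∑ k ∈ Finset.range N, S i k * T k j) N := by
      rw [leadingMinor_one_add, leadingMinor_one_add, ← Matrix.det_mul, leadingMinor_one_add]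
      congr 1
      rw [add_mul, one_mul, mul_add, mul_one]
      ext i j
      simp only [Matrix.add_apply, Matrix.submatrix_apply, Matrix.mul_apply, Matrix.of_apply,
        ← Fin.sum_univ_eq_sum_range (fun k => S i k * T k j)]
      ring
    rw [hprod]
    refine norm_leadingMinor_sub_le (β := b) (κ := c) (κ' := κ')
      (fun i _ j _ => hP.bound i j) hpos hN (fun i _ j _ => ?_)
      (sum_fin_le_of_summable hP.left_summable (fun i => sq_nonneg _) N)
      (sum_fin_le_of_summable hP.right_summable (fun i => sq_nonneg _) N)
      (sum_fin_le_of_summable hT.right_summable (fun i => sq_nonneg _) N)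
    have hsplit := (hS.summable_mul hT i j).sum_add_tsum_nat_add N
    have : (Matrix.of fun i j => S i j + T i j + ∑ k ∈ Finset.range N, S i k * T k j) i j -
        (S + T + KPTau.infMul S T) i j = -∑' k, S i (k + N) * T (k + N) j := by
      simp only [Matrix.of_apply, Matrix.add_apply, KPTau.infMul]
      rw [← hsplit]
      ring
    rw [this, norm_neg]
    refine (hS.norm_tsum_mul_le hT i j N).trans ?_
    have h0 : 0 ≤ β i * κ' j := mul_nonneg (hS.left_nonneg i) (hT.right_nonneg j)
    have h3 : β i * κ' j ≤ b i * κ' j :=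
      mul_le_mul_of_nonneg_right (by simp only [b]; linarith [hT.left_nonneg i, hS.left_nonneg i])
        (hT.right_nonneg j)
    refine mul_le_mul (le_add_of_nonneg_right (by positivity)) h3 h0 hpos.le
  have := tendsto_nhds_unique (h2.sub h1) hlim
  exact (sub_eq_zero.1 this).symm

theorem infDet_one_add_rankOne {u v : ℕ → ℂ} {β κ : ℕ → ℝ}
    (h : Dominated (Matrix.of fun i j => u i * v j) β κ) {s : ℂ}
    (hs : HasSum (fun i => u i * v i) s) :
    infDet (1 + Matrix.of fun i j => u i * v j) = 1 + s := by
  refine tendsto_nhds_unique h.tendsto_infDet ?_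
  refine (hs.tendsto_sum_nat.const_add 1).congr fun N => ?_
  rw [leadingMinor_one_add]
  have : (Matrix.of fun i j => u i * v j).submatrix (fun i : Fin N => (i : ℕ))
      (fun i : Fin N => (i : ℕ)) = Matrix.replicateCol Unit (fun i : Fin N => u i) *
        Matrix.replicateRow Unit (fun i : Fin N => v i) := by
    ext i j
    simp [Matrix.mul_apply]
  rw [this, Matrix.det_one_add_mul_comm]
  simp [Matrix.mul_apply, Matrix.det_unique, ← Fin.sum_univ_eq_sum_range (fun i => u i * v i),
    mul_comm]

/-! ### Hilbert–Schmidt operators -/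

section HilbertSchmidt

variable {E F G : Type} [NormedAddCommGroup E] [InnerProductSpace ℂ E]
  [NormedAddCommGroup F] [InnerProductSpace ℂ F] [NormedAddCommGroup G] [InnerProductSpace ℂ G]

theorem IsHilbertSchmidt.comp_left {T : E →L[ℂ] F} (hT : IsHilbertSchmidt T) (S : F →L[ℂ] G) :
    IsHilbertSchmidt (S ∘L T) := by
  obtain ⟨ι, b, hb⟩ := hT
  refine ⟨ι, b, Summable.of_nonneg_of_le (fun i => sq_nonneg _) (fun i => ?_)
    (hb.mul_left (‖S‖ ^ 2))⟩
  rw [← mul_pow]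
  gcongr
  exact S.le_opNorm _

theorem hasSum_norm_inner_sq {ι : Type*} (b : HilbertBasis ι ℂ E) (x : E) :
    HasSum (fun i => ‖inner ℂ (b i) x‖ ^ 2) (‖x‖ ^ 2) := by
  have h := b.hasSum_inner_mul_inner x x
  rw [inner_self_eq_norm_sq_to_K] at h
  have h2 : (fun i => inner ℂ x (b i) * inner ℂ (b i) x) =
      fun i => ((‖inner ℂ (b i) x‖ ^ 2 : ℝ) : ℂ) := by
    ext i
    rw [← inner_conj_symm x (b i), Complex.conj_mul']
    push_cast
    rfl
  rw [h2] at h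
  refine Complex.hasSum_ofReal.1 ?_
  simpa using h

variable [CompleteSpace E] [CompleteSpace F] [CompleteSpace G]

/-- The double sum `∑ |⟪T bᵢ, fⱼ⟫|²` may be summed in either order. -/
theorem IsHilbertSchmidt.summable_adjoint {T : E →L[ℂ] F} (hT : IsHilbertSchmidt T) {ι : Type*}
    {f : ι → F} (hf : Orthonormal ℂ f) : Summable fun j => ‖T.adjoint (f j)‖ ^ 2 := by
  obtain ⟨κ, b, hb⟩ := hT
  have hs : Summable fun p : κ × ι => ‖inner ℂ (f p.2) (T (b p.1))‖ ^ 2 := by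
    refine (summable_prod_of_nonneg fun p => sq_nonneg _).2
      ⟨fun i => hf.inner_products_summable (T (b i)), ?_⟩
    exact Summable.of_nonneg_of_le (fun i => tsum_nonneg fun j => sq_nonneg _)
      (fun i => hf.tsum_inner_products_le (T (b i))) hb
  have hs' := hs.prod_symm.prod
  refine hs'.congr fun j => ?_
  rw [← (hasSum_norm_inner_sq b (T.adjoint (f j))).tsum_eq]
  refine tsum_congr fun i => ?_
  rw [ContinuousLinearMap.adjoint_inner_right, norm_inner_symm]
  rfl

theorem IsHilbertSchmidt.adjoint {T : E →L[ℂ] F} (hT : IsHilbertSchmidt T) :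
    IsHilbertSchmidt T.adjoint := by
  obtain ⟨w, b, -⟩ := exists_hilbertBasis ℂ F
  exact ⟨w, b, hT.summable_adjoint b.orthonormal⟩

theorem IsHilbertSchmidt.summable_of_orthonormal {T : E →L[ℂ] F} (hT : IsHilbertSchmidt T)
    {ι : Type*} {f : ι → E} (hf : Orthonormal ℂ f) : Summable fun j => ‖T (f j)‖ ^ 2 := by
  simpa using hT.adjoint.summable_adjoint hf

theorem IsHilbertSchmidt.comp_right {T : F →L[ℂ] G} (hT : IsHilbertSchmidt T) (S : E →L[ℂ] F) :
    IsHilbertSchmidt (T ∘L S) := by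
  have := (hT.adjoint.comp_left S.adjoint).adjoint
  rwa [← ContinuousLinearMap.adjoint_comp, ContinuousLinearMap.adjoint_adjoint] at this

end HilbertSchmidt

/-! ### The monomial basis and matrices of operators -/

theorem orthonormal_basisVec : Orthonormal ℂ basisVec :=
  (orthonormal_fourier (T := 1)).comp (fun j : ℤ => -j - 1) fun a b h => by
    simp only at h; omega

theorem inner_basisVec (j : ℤ) (f : L2Circle) :
    inner ℂ (basisVec j) f = fourierCoeff f (-j - 1) := by
  rw [← fourierBasis_repr, HilbertBasis.repr_apply_apply, coe_fourierBasis]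
  rfl

theorem basisVec_mem_Hminus (n : ℕ) : basisVec n ∈ Hminus :=
  Submodule.le_topologicalClosure _ (Submodule.subset_span ⟨n, rfl⟩)

theorem orthonormal_monomial : Orthonormal ℂ monomial := by
  have : Orthonormal ℂ fun n : ℕ => basisVec (-(n : ℤ) - 1) :=
    orthonormal_basisVec.comp (fun n : ℕ => -(n : ℤ) - 1) fun a b h => by
      simp only at h; omega
  refine ⟨fun n => this.1 n, fun m n h => this.2 h⟩

/-- The orthonormal basis `1, z, z², …` of `H₊`. -/
noncomputable def monomialBasis : HilbertBasis ℕ ℂ Hplus :=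
  HilbertBasis.mkOfOrthogonalEqBot orthonormal_monomial (by
    rw [Submodule.eq_bot_iff]
    intro x hx
    rw [Submodule.mem_orthogonal] at hx
    have h1 : (x : L2Circle) ∈
        (Submodule.span ℂ (Set.range fun n : ℕ => basisVec (-(n : ℤ) - 1)))ᗮ := by
      rw [Submodule.mem_orthogonal]
      intro u hu
      have hle : Submodule.span ℂ (Set.range fun n : ℕ => basisVec (-(n : ℤ) - 1)) ≤
          (ℂ ∙ (x : L2Circle))ᗮ := by
        rw [Submodule.span_le]
        rintro _ ⟨n, rfl⟩
        exact Submodule.mem_orthogonal_singleton_iff_inner_left.2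
          (hx (monomial n) (Submodule.subset_span ⟨n, rfl⟩))
      exact Submodule.mem_orthogonal_singleton_iff_inner_left.1 (hle hu)
    rw [← Submodule.orthogonal_closure] at h1
    have h2 := (Submodule.mem_orthogonal _ _).1 h1 x x.2
    exact Subtype.ext (inner_self_eq_zero.1 h2))

@[simp]
theorem coe_monomialBasis : ⇑monomialBasis = monomial :=
  HilbertBasis.coe_mkOfOrthogonalEqBot _ _

/-- The matrix of an operator on `H₊` in the basis `1, z, z², …`. -/
noncomputable def opMatrix (T : Hplus →L[ℂ] Hplus) : Matrix ℕ ℕ ℂ :=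
  Matrix.of fun i j => inner ℂ (monomial i) (T (monomial j))

theorem opMatrix_comp (S T : Hplus →L[ℂ] Hplus) :
    opMatrix (S ∘L T) = infMul (opMatrix S) (opMatrix T) := by
  ext i j
  have h := monomialBasis.tsum_inner_mul_inner (S.adjoint (monomial i)) (T (monomial j))
  simp only [coe_monomialBasis, ContinuousLinearMap.adjoint_inner_left] at h
  exact h.symm

theorem opMatrix_add (S T : Hplus →L[ℂ] Hplus) :
    opMatrix (S + T) = opMatrix S + opMatrix T := by
  ext i j
  simp [opMatrix]

theorem IsTraceClass.exists_dominated {T : Hplus →L[ℂ] Hplus} (hT : IsTraceClass T) :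
    ∃ β κ : ℕ → ℝ, Dominated (opMatrix T) β κ := by
  obtain ⟨B, C, hB, hC, rfl⟩ := hT
  refine ⟨fun i => ‖B.adjoint (monomial i)‖, fun j => ‖C (monomial j)‖, fun i => norm_nonneg _,
    fun i => norm_nonneg _, hB.summable_adjoint orthonormal_monomial,
    hC.summable_of_orthonormal orthonormal_monomial, fun i j => ?_⟩
  simp only [opMatrix, Matrix.of_apply, ContinuousLinearMap.comp_apply]
  rw [← ContinuousLinearMap.adjoint_inner_left]
  exact norm_inner_le_norm _ _

theorem IsTraceClass.comp_left {T : Hplus →L[ℂ] Hplus} (hT : IsTraceClass T)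
    (S : Hplus →L[ℂ] Hplus) : IsTraceClass (S ∘L T) := by
  obtain ⟨B, C, hB, hC, rfl⟩ := hT
  exact ⟨S ∘L B, C, hB.comp_left S, hC, rfl⟩

theorem inner_monomial_projPlus (n : ℕ) (f : L2Circle) :
    inner ℂ (monomial n) (projPlus f) = fourierCoeff f n := by
  rw [projPlus, Submodule.inner_orthogonalProjectionOnto_eq_of_mem_left]
  refine (inner_basisVec _ f).trans ?_
  congr 1
  ring

theorem inner_basisVec_projMinus (n : ℕ) (f : L2Circle) :
    inner ℂ (basisVec n) (projMinus f : L2Circle) = fourierCoeff f (-(n : ℤ) - 1) := by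
  have := Submodule.inner_orthogonalProjectionOnto_eq_of_mem_left (K := Hminus)
    ⟨basisVec n, basisVec_mem_Hminus n⟩ f
  rw [← inner_basisVec]
  exact this

/-! ### Admissible frames -/

/-- The trace class part `W₊ - 1` of a frame. -/
noncomputable def framePerturbation (W : Hplus →L[ℂ] L2Circle) : Hplus →L[ℂ] Hplus :=
  plusBlock W - ContinuousLinearMap.id ℂ Hplus

theorem opMatrix_framePerturbation (W : Hplus →L[ℂ] L2Circle) (i j : ℕ) :
    (1 + opMatrix (framePerturbation W)) i j = fourierCoeff (W (monomial j)) i := by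
  have h1 : inner ℂ (monomial i) (monomial j) = (1 : Matrix ℕ ℕ ℂ) i j := by
    rw [Matrix.one_apply, orthonormal_iff_ite.1 orthonormal_monomial]
  have h2 : inner ℂ (monomial i) (plusBlock W (monomial j)) = fourierCoeff (W (monomial j)) i :=
    inner_monomial_projPlus i _
  simp only [Matrix.add_apply, opMatrix, framePerturbation, Matrix.of_apply,
    _root_.sub_apply, inner_sub_right, ContinuousLinearMap.id_apply, h1, h2]
  ring

section Frame

variable {w : Submodule ℂ L2Circle} {W : Hplus →L[ℂ] L2Circle}

theorem IsAdmissibleFrame.isHilbertSchmidt_minusBlock (hW : IsAdmissibleFrame W w)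
    (hw : InGrassmannian w) : IsHilbertSchmidt (minusBlock W) := by
  have : CompleteSpace w := hw.isClosed.completeSpace_coe
  have hmem : ∀ x, W x ∈ w := fun x => hW.range_eq ▸ ⟨x, rfl⟩
  exact hw.hilbertSchmidt.comp_right (W.codRestrict w hmem)

theorem IsAdmissibleFrame.isInvertible_plusBlock (hW : IsAdmissibleFrame W w) (hw : InBigCell w) :
    (plusBlock W).IsInvertible := by
  have hmem : ∀ x, W x ∈ w := fun x => hW.range_eq ▸ ⟨x, rfl⟩
  have hbij : Function.Bijective (W.codRestrict w hmem) := by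
    refine ⟨fun x y h => hW.injective (congrArg Subtype.val h), fun y => ?_⟩
    obtain ⟨x, hx⟩ : (y : L2Circle) ∈ W.range := hW.range_eq ▸ y.2
    exact ⟨x, Subtype.ext hx⟩
  have h : Function.Bijective (plusBlock W) := hw.bijective.comp hbij
  refine ⟨ContinuousLinearEquiv.ofBijective (plusBlock W) (LinearMap.ker_eq_bot.2 h.1)
    (LinearMap.range_eq_top.2 h.2), ?_⟩
  exact ContinuousLinearEquiv.coe_ofBijective _ _ _

/-- The determinant of `W₊` times the determinant of its inverse is `1`. -/
theorem IsAdmissibleFrame.infDet_plus_ne_zero (hW : IsAdmissibleFrame W w) (hw : InBigCell w) :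
    infDet (1 + opMatrix (framePerturbation W)) ≠ 0 := by
  set T := framePerturbation W with hT
  set V := (plusBlock W).inverse with hV
  have hinv := hW.isInvertible_plusBlock hw
  have hWT : plusBlock W = ContinuousLinearMap.id ℂ Hplus + T := by
    rw [hT, framePerturbation]; abel
  obtain ⟨β, κ, hd⟩ : ∃ β κ, Dominated (opMatrix T) β κ := hW.traceClass.exists_dominated
  obtain ⟨β', κ', hd'⟩ : ∃ β κ, Dominated (opMatrix ((-V) ∘L T)) β κ :=
    (hW.traceClass.comp_left (-V)).exists_dominated
  have hVW : V ∘L plusBlock W = ContinuousLinearMap.id ℂ Hplus := hinv.inverse_comp_self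
  have hVT : V + V ∘L T = ContinuousLinearMap.id ℂ Hplus := by
    rw [← hVW, hWT]
    ext x
    simp
  -- The inverse of `1 + T` is `V = 1 - V T`.
  have hzero : (-V) ∘L T + T + ((-V) ∘L T) ∘L T = 0 := by
    ext1 x
    have := congrArg (fun L : Hplus →L[ℂ] Hplus => L (T x)) hVT
    simp only [_root_.add_apply, ContinuousLinearMap.comp_apply,
      ContinuousLinearMap.id_apply] at this
    simp only [_root_.add_apply, ContinuousLinearMap.comp_apply,
      _root_.neg_apply, _root_.zero_apply]
    exact Eq.trans (by abel) (sub_eq_zero.2 this.symm)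
  have hmul := Dominated.infDet_mul hd' hd
  rw [← opMatrix_comp] at hmul
  have h0 : opMatrix ((-V) ∘L T) + opMatrix T + opMatrix (((-V) ∘L T) ∘L T) = 0 := by
    rw [← opMatrix_add, ← opMatrix_add, hzero]
    ext i j
    simp [opMatrix]
  rw [h0, add_zero] at hmul
  have h1 : infDet (1 : Matrix ℕ ℕ ℂ) = 1 := by
    refine Tendsto.limUnder_eq (tendsto_const_nhds.congr fun N => ?_)
    have h := leadingMinor_one_add 0 N
    simp only [add_zero, Matrix.submatrix_zero, Pi.zero_apply, Matrix.det_one] at h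
    exact h.symm
  rw [h1] at hmul
  intro h
  rw [h, mul_zero] at hmul
  exact one_ne_zero hmul

theorem exists_norm_affineCoord_le (W : Hplus →L[ℂ] L2Circle) :
    ∃ C : ℝ, ∀ a b, ‖affineCoord W a b‖ ≤ C := by
  refine ⟨‖minusBlock W ∘L (plusBlock W).inverse‖, fun a b => ?_⟩
  refine (norm_inner_le_norm _ _).trans ?_
  rw [orthonormal_basisVec.1, one_mul]
  refine ((minusBlock W ∘L (plusBlock W).inverse).le_opNorm _).trans (le_of_eq ?_)
  rw [orthonormal_monomial.1, mul_one]

/-- The vector of `H₋` whose inner product with `∑ c_l e_l` is `∑ x ^ l * c_l`. -/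
noncomputable def geomVec (x : ℂ) : L2Circle := ∑' l : ℕ, (starRingEnd ℂ x) ^ l • basisVec l

theorem hasSum_inner_geomVec {x : ℂ} (hx : ‖x‖ < 1) (f : L2Circle) :
    HasSum (fun l : ℕ => x ^ l * inner ℂ (basisVec l) f) (inner ℂ (geomVec x) f) := by
  have hs : Summable fun l : ℕ => (starRingEnd ℂ x) ^ l • basisVec l := by
    refine Summable.of_norm ?_
    simp only [norm_smul, orthonormal_basisVec.1, mul_one, norm_pow, RCLike.norm_conj]
    exact summable_geometric_of_lt_one (norm_nonneg _) hx
  have h := ((innerSL ℂ f).hasSum hs.hasSum).star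
  simp only [innerSL_apply_apply, inner_smul_right, ← starRingEnd_apply, map_mul, map_pow,
    inner_conj_symm, Complex.conj_conj] at h
  exact h

/-- The perturbation of `W₊` by the rank one matrix `(x - y) y ^ i ∑ x ^ l W_{l j}` multiplies the
determinant by `1 + (x - y) ∑ x ^ a y ^ b A_{a b}`, since `W₊ + u ⊗ v = (1 + u ⊗ v W₊⁻¹) W₊`. -/
theorem IsAdmissibleFrame.infDet_rankOne_perturbation (hW : IsAdmissibleFrame W w)
    (hw : InBigCell w) {x y : ℂ} (hx : ‖x‖ < 1) (hy : ‖y‖ < 1) :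
    infDet (1 + (opMatrix (framePerturbation W) + Matrix.of fun i j =>
        (x - y) * y ^ i * ∑' l : ℕ, x ^ l * fourierCoeff (W (monomial j)) (-(l : ℤ) - 1))) =
      infDet (1 + opMatrix (framePerturbation W)) *
        (1 + (x - y) * ∑' b, y ^ b * ∑' a, x ^ a * affineCoord W a b) := by
  set T := framePerturbation W with hT
  set A := minusBlock W ∘L (plusBlock W).inverse with hA
  have hinv := hW.isInvertible_plusBlock hw
  have hWT : plusBlock W = ContinuousLinearMap.id ℂ Hplus + T := by
    rw [hT, framePerturbation]; abel
  have hAW : A + A ∘L T = minusBlock W := by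
    have h : A ∘L plusBlock W = minusBlock W := by
      rw [hA, ContinuousLinearMap.comp_assoc, hinv.inverse_comp_self,
        ContinuousLinearMap.comp_id]
    rw [← h, hWT]
    ext v
    simp
  have hAHS : IsHilbertSchmidt A :=
    (hW.isHilbertSchmidt_minusBlock hw.toInGrassmannian).comp_right _
  obtain ⟨β, κ, hd⟩ : ∃ β κ, Dominated (opMatrix T) β κ := hW.traceClass.exists_dominated
  set η := A.adjoint (projMinus (geomVec x)) with hη
  have hηA : ∀ v, inner ℂ η v = inner ℂ (geomVec x) (A v : L2Circle) := fun v => by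
    rw [hη, ContinuousLinearMap.adjoint_inner_left, projMinus,
      Submodule.inner_orthogonalProjectionOnto_eq_of_mem_right]
  have hρ : ∀ b, ∑' a, x ^ a * affineCoord W a b = inner ℂ η (monomial b) := fun b => by
    rw [hηA]
    exact (hasSum_inner_geomVec hx _).tsum_eq
  have hω : ∀ j, ∑' l : ℕ, x ^ l * fourierCoeff (W (monomial j)) (-(l : ℤ) - 1) =
      inner ℂ η (monomial j) + inner ℂ η (T (monomial j)) := fun j => by
    rw [hηA, hηA, ← inner_add_right, ← Submodule.coe_add]
    have : A (monomial j) + A (T (monomial j)) = minusBlock W (monomial j) := by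
      rw [← hAW]; rfl
    rw [this, ← (hasSum_inner_geomVec hx _).tsum_eq]
    refine tsum_congr fun l => ?_
    rw [← inner_basisVec_projMinus]
    rfl
  simp only [hρ, hω]
  set R : Matrix ℕ ℕ ℂ := Matrix.of fun i j =>
    ((x - y) * y ^ i) * inner ℂ η (monomial j) with hR
  have hRd : Dominated R (fun i => ‖(x - y) * y ^ i‖)
      (fun j => ‖geomVec x‖ * ‖A (monomial j)‖) := by
    refine ⟨fun i => norm_nonneg _, fun j => by positivity, ?_, ?_, fun i j => ?_⟩
    · simp only [norm_mul, mul_pow, norm_pow, ← pow_mul]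
      refine Summable.mul_left _ ?_
      simp only [mul_comm _ 2, pow_mul]
      exact summable_geometric_of_lt_one (by positivity)
        (pow_lt_one₀ (norm_nonneg _) hy two_ne_zero)
    · simp only [mul_pow]
      exact (hAHS.summable_of_orthonormal orthonormal_monomial).mul_left _
    · rw [hR, Matrix.of_apply, norm_mul, hηA]
      exact mul_le_mul_of_nonneg_left (norm_inner_le_norm _ _) (norm_nonneg _)
  have hmul := hRd.infDet_mul hd
  have hRT : infMul R (opMatrix T) =
      Matrix.of fun i j => ((x - y) * y ^ i) * inner ℂ η (T (monomial j)) := by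
    ext i j
    have h := monomialBasis.tsum_inner_mul_inner η (T (monomial j))
    simp only [coe_monomialBasis] at h
    simp only [infMul, hR, Matrix.of_apply, opMatrix, mul_assoc, tsum_mul_left, h]
  have hsum : Summable fun b : ℕ => y ^ b * inner ℂ η (monomial b) := by
    refine Summable.of_norm_bounded
      ((summable_geometric_of_lt_one (norm_nonneg _) hy).mul_right ‖η‖) fun b => ?_
    rw [norm_mul, norm_pow]
    have h := norm_inner_le_norm (𝕜 := ℂ) η (monomial b)
    rw [orthonormal_monomial.1, mul_one] at h
    gcongr
  have hone := infDet_one_add_rankOne (u := fun i => (x - y) * y ^ i)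
    (v := fun j => inner ℂ η (monomial j)) hRd
    (s := (x - y) * ∑' b, y ^ b * inner ℂ η (monomial b))
    (by simpa only [mul_assoc] using hsum.hasSum.mul_left (x - y))
  rw [mul_comm (infDet _), ← hone]
  refine Eq.trans ?_ hmul
  congr 2
  rw [hRT]
  ext i j
  simp only [hR, Matrix.add_apply, Matrix.of_apply]
  ring

end Frame

/-! ### Taylor coefficients -/

/-- The `n`-th Taylor coefficient at `0`. -/
noncomputable def taylorCoeff (f : ℂ → ℂ) (n : ℕ) : ℂ := iteratedDeriv n f 0 / (n.factorial : ℂ)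

theorem taylorCoeff_zero (f : ℂ → ℂ) : taylorCoeff f 0 = f 0 := by
  simp [taylorCoeff]

theorem taylorCoeff_mul {f g : ℂ → ℂ} {n : ℕ} (hf : ContDiffAt ℂ n f 0) (hg : ContDiffAt ℂ n g 0) :
    taylorCoeff (fun z => f z * g z) n =
      ∑ k ∈ Finset.range (n + 1), taylorCoeff f k * taylorCoeff g (n - k) := by
  rw [taylorCoeff, iteratedDeriv_fun_mul hf hg, Finset.sum_div]
  refine Finset.sum_congr rfl fun k hk => ?_
  have hkn : k ≤ n := Nat.lt_succ_iff.1 (Finset.mem_range.1 hk)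
  have h1 : (k.factorial : ℂ) ≠ 0 := by exact_mod_cast k.factorial_ne_zero
  have h2 : ((n - k).factorial : ℂ) ≠ 0 := by exact_mod_cast (n - k).factorial_ne_zero
  have h3 : (n.factorial : ℂ) ≠ 0 := by exact_mod_cast n.factorial_ne_zero
  rw [Nat.cast_choose ℂ hkn, taylorCoeff, taylorCoeff]
  field_simp

theorem taylorCoeff_pow (m n : ℕ) : taylorCoeff (fun z => z ^ m) n = if n = m then 1 else 0 := by
  rw [taylorCoeff, iteratedDeriv_fun_pow_zero]
  split_ifs with h
  · subst h
    exact div_self (by exact_mod_cast n.factorial_ne_zero)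
  · simp

theorem taylorCoeff_const_mul (c : ℂ) (f : ℂ → ℂ) (n : ℕ) :
    taylorCoeff (fun z => c * f z) n = c * taylorCoeff f n := by
  rw [taylorCoeff, taylorCoeff, iteratedDeriv_const_mul_field, mul_div_assoc]

theorem taylorCoeff_sum {ι : Type*} {s : Finset ι} {f : ι → ℂ → ℂ} {n : ℕ}
    (hf : ∀ i ∈ s, ContDiffAt ℂ n (f i) 0) :
    taylorCoeff (fun z => ∑ i ∈ s, f i z) n = ∑ i ∈ s, taylorCoeff (f i) n := by
  rw [taylorCoeff, iteratedDeriv_fun_sum hf, Finset.sum_div]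
  rfl

theorem taylorCoeff_sub {f g : ℂ → ℂ} {n : ℕ} (hf : ContDiffAt ℂ n f 0) (hg : ContDiffAt ℂ n g 0) :
    taylorCoeff (fun z => f z - g z) n = taylorCoeff f n - taylorCoeff g n := by
  rw [taylorCoeff, iteratedDeriv_fun_sub hf hg, sub_div]
  rfl

theorem taylorCoeff_mul_linear {f : ℂ → ℂ} {n : ℕ} (a b : ℂ) (hf : ContDiffAt ℂ (n + 1 : ℕ) f 0) :
    taylorCoeff (fun z => (a - b * z) * f z) (n + 1) =
      a * taylorCoeff f (n + 1) - b * taylorCoeff f n := by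
  have h : (fun z => (a - b * z) * f z) = fun z => a * f z - b * (z ^ 1 * f z) := by
    ext z; ring
  have h1 : ContDiffAt ℂ (n + 1 : ℕ) (fun z : ℂ => z ^ 1) 0 := by fun_prop
  rw [h, taylorCoeff_sub (by fun_prop) (by fun_prop), taylorCoeff_const_mul, taylorCoeff_const_mul,
    taylorCoeff_mul h1 hf, Finset.sum_eq_single 1]
  · rw [taylorCoeff_pow 1, if_pos rfl, one_mul, Nat.add_sub_cancel]
  · intro k _ hk
    rw [taylorCoeff_pow 1, if_neg hk, zero_mul]
  · simp

theorem norm_taylorCoeff_le {f : ℂ → ℂ} {r C : ℝ} (n : ℕ) (hr : 0 < r)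
    (hf : DiffContOnCl ℂ f (Metric.ball 0 r)) (hC : ∀ z ∈ Metric.sphere (0 : ℂ) r, ‖f z‖ ≤ C) :
    ‖taylorCoeff f n‖ ≤ C / r ^ n := by
  have h := Complex.norm_iteratedDeriv_le_of_forall_mem_sphere_norm_le n hr hf hC
  have h3 : (0 : ℝ) < n.factorial := by exact_mod_cast n.factorial_pos
  rw [taylorCoeff, norm_div, Complex.norm_natCast, div_le_iff₀ h3]
  exact h.trans (le_of_eq (by ring))

/-! ### The generating function of the flow -/

/-- The weighted `ℓ¹` bound `∑ |t_i| r ^ i ≤ R`. -/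
structure FlowNormLE (t : ℕ+ → ℂ) (r R : ℝ) : Prop where
  summable : Summable fun i : ℕ+ => ‖t i‖ * r ^ (i : ℕ)
  tsum_le : ∑' i : ℕ+, ‖t i‖ * r ^ (i : ℕ) ≤ R

theorem FlowNormLE.neg {t : ℕ+ → ℂ} {r R : ℝ} (h : FlowNormLE t r R) : FlowNormLE (-t) r R :=
  ⟨by simpa using h.summable, by simpa using h.tsum_le⟩

/-- The generating function `exp (∑ t_i z ^ i)`, a holomorphic extension of `γ(t)`. -/
noncomputable def genFun (t : ℕ+ → ℂ) (z : ℂ) : ℂ := Complex.exp (∑' i : ℕ+, t i * z ^ (i : ℕ))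

/-- The Taylor coefficients `h_n(t)` of `exp (∑ t_i z ^ i)`. -/
noncomputable def flowCoeff (t : ℕ+ → ℂ) (n : ℕ) : ℂ := taylorCoeff (genFun t) n

section genFun

variable {t t' : ℕ+ → ℂ} {r R ε : ℝ}

theorem norm_term_le {z : ℂ} (hz : ‖z‖ ≤ r) (i : ℕ+) :
    ‖t i * z ^ (i : ℕ)‖ ≤ ‖t i‖ * r ^ (i : ℕ) := by
  rw [norm_mul, norm_pow]
  gcongr

theorem FlowNormLE.summable_mul_pow (h : FlowNormLE t r R) {z : ℂ} (hz : ‖z‖ ≤ r) :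
    Summable fun i : ℕ+ => t i * z ^ (i : ℕ) :=
  Summable.of_norm_bounded h.summable fun i => norm_term_le hz i

theorem FlowNormLE.norm_tsum_le (h : FlowNormLE t r R) {z : ℂ} (hz : ‖z‖ ≤ r) :
    ‖∑' i : ℕ+, t i * z ^ (i : ℕ)‖ ≤ R :=
  (tsum_of_norm_bounded h.summable.hasSum fun i => norm_term_le hz i).trans h.tsum_le

theorem FlowNormLE.norm_genFun_le (h : FlowNormLE t r R) {z : ℂ} (hz : ‖z‖ ≤ r) :
    ‖genFun t z‖ ≤ Real.exp R := by
  rw [genFun, Complex.norm_exp, Real.exp_le_exp]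
  exact (Complex.re_le_norm _).trans (h.norm_tsum_le hz)

theorem FlowNormLE.diffContOnCl (h : FlowNormLE t r R) :
    DiffContOnCl ℂ (genFun t) (Metric.ball 0 r) := by
  have h1 : DifferentiableOn ℂ (fun z : ℂ => ∑' i : ℕ+, t i * z ^ (i : ℕ)) (Metric.ball 0 r) :=
    Complex.differentiableOn_tsum_of_summable_norm h.summable (fun i => by fun_prop)
      Metric.isOpen_ball fun i _ hz => norm_term_le (mem_ball_zero_iff.1 hz).le i
  have h2 : ContinuousOn (fun z : ℂ => ∑' i : ℕ+, t i * z ^ (i : ℕ)) (Metric.closedBall 0 r) :=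
    continuousOn_tsum (fun i => by fun_prop) h.summable fun i z hz =>
      norm_term_le (mem_closedBall_zero_iff.1 hz) i
  exact ⟨h1.cexp, (h2.cexp).mono Metric.closure_ball_subset_closedBall⟩

theorem FlowNormLE.contDiffAt (h : FlowNormLE t r R) (hr : 0 < r) (n : ℕ) :
    ContDiffAt ℂ n (genFun t) 0 :=
  (h.diffContOnCl.differentiableOn.analyticAt (Metric.ball_mem_nhds 0 hr)).contDiffAt

theorem FlowNormLE.norm_flowCoeff_le (h : FlowNormLE t r R) (hr : 0 < r) (n : ℕ) :
    ‖flowCoeff t n‖ ≤ Real.exp R / r ^ n :=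
  norm_taylorCoeff_le n hr h.diffContOnCl fun _ hz =>
    h.norm_genFun_le (mem_sphere_zero_iff_norm.1 hz).le

theorem FlowNormLE.hasSum_flowCoeff (h : FlowNormLE t r R) {z : ℂ} (hz : ‖z‖ < r) :
    HasSum (fun n => flowCoeff t n * z ^ n) (genFun t z) := by
  have := Complex.hasSum_taylorSeries_on_ball h.diffContOnCl.differentiableOn
    (mem_ball_zero_iff.2 hz)
  refine this.congr_fun fun n => ?_
  simp only [flowCoeff, taylorCoeff, sub_zero, smul_eq_mul]
  ring

theorem flowCoeff_zero_right (t : ℕ+ → ℂ) : flowCoeff t 0 = 1 := by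
  simp [flowCoeff, taylorCoeff_zero, genFun]

theorem genFun_neg_mul (t : ℕ+ → ℂ) (z : ℂ) : genFun (-t) z * genFun t z = 1 := by
  simp [genFun, tsum_neg, ← Complex.exp_add]

/-- `h(-t) * h(t) = 1` as formal power series. -/
theorem FlowNormLE.mk_flowCoeff_neg_mul (h : FlowNormLE t r R) (hr : 0 < r) :
    PowerSeries.mk (flowCoeff (-t)) * PowerSeries.mk (flowCoeff t) = 1 := by
  ext n
  have h1 := taylorCoeff_mul (h.neg.contDiffAt hr n) (h.contDiffAt hr n)
  simp only [genFun_neg_mul] at h1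
  have h2 := taylorCoeff_pow 0 n
  simp only [pow_zero] at h2
  rw [PowerSeries.coeff_mul, Finset.Nat.sum_antidiagonal_eq_sum_range_succ_mk,
    PowerSeries.coeff_one, ← h2, h1]
  simp [flowCoeff]

theorem FlowNormLE.norm_flowCoeff_sub_le (h : FlowNormLE t r R) (h' : FlowNormLE t' r R)
    (hd : FlowNormLE (t' - t) r ε) (hε : ε ≤ 1) (hr : 0 < r) (n : ℕ) :
    ‖flowCoeff t' n - flowCoeff t n‖ ≤ 2 * ε * Real.exp R / r ^ n := by
  rw [flowCoeff, flowCoeff, ← taylorCoeff_sub (h'.contDiffAt hr n) (h.contDiffAt hr n)]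
  refine norm_taylorCoeff_le n hr (h'.diffContOnCl.sub h.diffContOnCl) fun z hz => ?_
  have hz' : ‖z‖ ≤ r := (mem_sphere_zero_iff_norm.1 hz).le
  have h1 : genFun t' z - genFun t z = (genFun (t' - t) z - 1) * genFun t z := by
    rw [sub_mul, one_mul]
    congr 1
    rw [genFun, genFun, genFun, ← Complex.exp_add, ← (hd.summable_mul_pow hz').tsum_add
      (h.summable_mul_pow hz')]
    congr 2
    ext i
    simp only [Pi.sub_apply]
    ring
  have h2 := hd.norm_tsum_le hz'
  have h3 : ‖genFun (t' - t) z - 1‖ ≤ 2 * ε :=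
    (Complex.norm_exp_sub_one_le (h2.trans hε)).trans (by linarith)
  rw [h1, norm_mul]
  exact mul_le_mul h3 (h.norm_genFun_le hz') (norm_nonneg _)
    (by linarith [norm_nonneg (∑' i : ℕ+, (t' - t) i * z ^ (i : ℕ))])

end genFun

/-! ### The matrix of the flow -/

theorem flow_eq_genFun (t : ℕ+ → ℂ) (x : AddCircle (1 : ℝ)) :
    flow t x = genFun t (fourier 1 x) := by
  rw [flow, genFun]
  congr 2
  ext i
  rw [fourier_apply, fourier_one, AddCircle.toCircle_zsmul]
  simp

theorem norm_fourier_apply (n : ℤ) (x : AddCircle (1 : ℝ)) : ‖(fourier n x : ℂ)‖ = 1 := by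
  rw [fourier_apply]; exact Circle.norm_coe _

theorem integrable_L2Circle (f : L2Circle) :
    Integrable f (AddCircle.haarAddCircle (T := (1 : ℝ))) :=
  (Lp.memLp f).integrable (by norm_num)

theorem FlowNormLE.hasSum_fourierCoeff {t : ℕ+ → ℂ} {r R : ℝ} (h : FlowNormLE t r R) (hr : 1 < r)
    (f : L2Circle) (m : ℤ) :
    HasSum (fun n : ℕ => flowCoeff t n * fourierCoeff f (m - n))
      (fourierCoeff (fun x => flow t x * f x) m) := by
  have hint : ∀ n : ℕ, Integrable (fun x => flowCoeff t n * (fourier (-(m - n)) x • f x))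
      (AddCircle.haarAddCircle (T := (1 : ℝ))) := fun n =>
    ((integrable_L2Circle f).fourier_smul (-(m - n))).const_mul _
  have key := hasSum_integral_of_summable_integral_norm hint ?_
  · have e : fourierCoeff (fun x => flow t x * f x) m =
        ∫ x, ∑' n : ℕ, flowCoeff t n * (fourier (-(m - n)) x • f x)
          ∂(AddCircle.haarAddCircle (T := (1 : ℝ))) := by
      refine integral_congr_ae (.of_forall fun x => ?_)
      have hs := (h.hasSum_flowCoeff (z := fourier 1 x)
        (by rw [norm_fourier_apply]; exact hr)).mul_left (fourier (-m) x * f x)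
      have : ∀ n : ℕ, (fourier (-m) x * f x : ℂ) * (flowCoeff t n * (fourier 1 x) ^ n) =
          flowCoeff t n * (fourier (-(m - n)) x • f x) := fun n => by
        have h1 : (fourier 1 x : ℂ) ^ n = fourier n x := by
          rw [fourier_one, fourier_apply, AddCircle.toCircle_zsmul]; simp
        have h2 : -(m - n) = -m + (n : ℤ) := by ring
        rw [h1, h2, fourier_add, smul_eq_mul]
        ring
      simp only [this, ← flow_eq_genFun] at hs
      refine Eq.trans ?_ hs.tsum_eq.symm
      simp only [smul_eq_mul]
      ring
    rw [e]
    refine key.congr_fun fun n => ?_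
    rw [integral_const_mul]
    rfl
  · have hn : ∀ n : ℕ, ∫ x, ‖flowCoeff t n * (fourier (-(m - n)) x • f x)‖
        ∂(AddCircle.haarAddCircle (T := (1 : ℝ))) =
        ‖flowCoeff t n‖ * ∫ x, ‖f x‖ ∂(AddCircle.haarAddCircle (T := (1 : ℝ))) := fun n => by
      rw [← integral_const_mul]
      simp only [norm_mul, norm_smul, norm_fourier_apply, one_mul]
    simp only [hn]
    refine Summable.mul_right _ (Summable.of_nonneg_of_le (fun n => norm_nonneg _)
      (fun n => h.norm_flowCoeff_le (by linarith) n) ?_)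
    simp only [div_eq_mul_inv, ← inv_pow]
    exact (summable_geometric_of_lt_one (by positivity) (inv_lt_one_of_one_lt₀ hr)).mul_left _

/-- The operator `a⁻¹ b : H₋ → H₊`, where `a : H₊ → H₊` and `b : H₋ → H₊` are the blocks of
multiplication by the series with coefficients `g`, and `a⁻¹` is multiplication by the series with
coefficients `g'`. -/
def hankelMatrix (g' g : ℕ → ℂ) : Matrix ℕ ℕ ℂ :=
  Matrix.of fun i l => ∑ k ∈ Finset.range (i + 1), g' k * g (i - k + l + 1)

theorem norm_hankelMatrix_le {g' g : ℕ → ℂ} {r C' C : ℝ} (hr : 0 < r)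
    (hg' : ∀ n, ‖g' n‖ ≤ C' / r ^ n) (hg : ∀ n, ‖g n‖ ≤ C / r ^ n) (i l : ℕ) :
    ‖hankelMatrix g' g i l‖ ≤ C' * C * (((i : ℝ) + 1) / r ^ i) * (1 / r ^ (l + 1)) := by
  rw [hankelMatrix, Matrix.of_apply]
  refine (norm_sum_le _ _).trans ?_
  have : ∀ k ∈ Finset.range (i + 1), ‖g' k * g (i - k + l + 1)‖ ≤ C' * C / r ^ (i + (l + 1)) := by
    intro k hk
    have hk' : k ≤ i := Nat.lt_succ_iff.1 (Finset.mem_range.1 hk)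
    rw [norm_mul]
    refine (mul_le_mul (hg' k) (hg _) (norm_nonneg _) ((norm_nonneg _).trans (hg' k))).trans ?_
    rw [div_mul_div_comm, ← pow_add]
    refine le_of_eq ?_
    congr 2
    omega
  refine (Finset.sum_le_sum this).trans (le_of_eq ?_)
  rw [Finset.sum_const, Finset.card_range, nsmul_eq_mul, pow_add]
  push_cast
  field_simp

/-- The matrix `a⁻¹ b W₋` by which the flow perturbs `W₊`. -/
noncomputable def flowPerturbation (W : Hplus →L[ℂ] L2Circle) (t : ℕ+ → ℂ) : Matrix ℕ ℕ ℂ :=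
  Matrix.of fun i j => ∑' l : ℕ, hankelMatrix (flowCoeff (-t)) (flowCoeff t) i l *
    fourierCoeff (W (monomial j)) (-(l : ℤ) - 1)

theorem det_lowerToeplitz {g : ℕ → ℂ} (hg : g 0 = 1) (N : ℕ) :
    (Matrix.of fun i k : Fin N => if (k : ℕ) ≤ i then g (i - k) else 0).det = 1 := by
  rw [Matrix.det_of_isLowerTriangular]
  · simp [hg]
  · intro i j hij
    have : ¬ (j : ℕ) ≤ i := by simpa using hij
    rw [Matrix.of_apply, if_neg this]

theorem sum_range_reflect_le (f : ℕ → ℂ) {i N : ℕ} (hi : i < N) (g : ℕ → ℂ) :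
    ∑ k ∈ Finset.range N, (if k ≤ i then g (i - k) else 0) * f k =
      ∑ k ∈ Finset.range (i + 1), g k * f (i - k) := by
  rw [← Finset.sum_subset (Finset.range_subset_range.2 (Nat.succ_le_of_lt hi)),
    ← Finset.sum_range_reflect]
  · refine Finset.sum_congr rfl fun k hk => ?_
    have hk' : k ≤ i := Nat.lt_succ_iff.1 (Finset.mem_range.1 hk)
    have h1 : i + 1 - 1 - k = i - k := by omega
    have h2 : i - (i - k) = k := by omega
    simp only [Nat.succ_eq_add_one, h1, h2, Nat.sub_le, if_true]
  · intro k _ hk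
    rw [if_neg (by simpa [Nat.lt_succ_iff] using hk), zero_mul]

/-- Left multiplication by the unipotent lower triangular Toeplitz matrix of `γ(-t)` turns the block
`W₊(t)` into `W₊ + a⁻¹ b W₋` and does not change the leading minors. -/
theorem FlowNormLE.leadingMinor_flowPlusBlock {t : ℕ+ → ℂ} {r R : ℝ} (h : FlowNormLE t r R)
    (hr : 1 < r) (W : Hplus →L[ℂ] L2Circle) (N : ℕ) :
    leadingMinor (flowPlusBlock W t) N =
      leadingMinor (1 + (opMatrix (framePerturbation W) + flowPerturbation W t)) N := by
  have hr0 : 0 < r := by linarith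
  rw [leadingMinor, leadingMinor, ← one_mul (Matrix.det _),
    ← det_lowerToeplitz (flowCoeff_zero_right (-t)) N, ← Matrix.det_mul]
  congr 1
  ext i j
  set f := W (monomial j) with hf
  have hent : ∀ k, flowPlusBlock W t k j = fourierCoeff (fun x => flow t x * f x) k := fun k => by
    simp only [flowPlusBlock, homogCoord, Matrix.submatrix_apply, Matrix.of_apply, id]
    congr 1
    ring
  have hsum : ∀ k : ℕ, HasSum (fun l : ℕ => flowCoeff t (k + l + 1) * fourierCoeff f (-(l : ℤ) - 1))
      (flowPlusBlock W t k j -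
        ∑ n ∈ Finset.range (k + 1), flowCoeff t n * fourierCoeff f ((k - n : ℕ) : ℤ)) := fun k => by
    have h1 := (hasSum_nat_add_iff' (k + 1)).2 (h.hasSum_fourierCoeff hr f k)
    rw [hent]
    have e : ∑ n ∈ Finset.range (k + 1), flowCoeff t n * fourierCoeff f ((k - n : ℕ) : ℤ) =
        ∑ n ∈ Finset.range (k + 1), flowCoeff t n * fourierCoeff f ((k : ℤ) - n) := by
      refine Finset.sum_congr rfl fun n hn => ?_
      have hn' : n ≤ k := Nat.lt_succ_iff.1 (Finset.mem_range.1 hn)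
      rw [Nat.cast_sub hn']
    rw [e]
    refine h1.congr_fun fun l => ?_
    have e1 : l + (k + 1) = k + l + 1 := by ring
    have e2 : (k : ℤ) - ((k + l + 1 : ℕ) : ℤ) = -(l : ℤ) - 1 := by push_cast; ring
    rw [e1, e2]
  simp only [Matrix.mul_apply, Matrix.of_apply, Matrix.submatrix_apply]
  rw [Fin.sum_univ_eq_sum_range (fun k => (if k ≤ (i : ℕ) then flowCoeff (-t) (i - k) else 0) *
    flowPlusBlock W t k j), sum_range_reflect_le _ i.2]
  have hsplit : ∀ k : ℕ, flowPlusBlock W t k j =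
      ∑ n ∈ Finset.range (k + 1), flowCoeff t n * fourierCoeff f ((k - n : ℕ) : ℤ) +
        ∑' l : ℕ, flowCoeff t (k + l + 1) * fourierCoeff f (-(l : ℤ) - 1) := fun k => by
    rw [(hsum k).tsum_eq]; ring
  simp only [hsplit, mul_add, Finset.sum_add_distrib]
  rw [← add_assoc, Matrix.add_apply, opMatrix_framePerturbation]
  congr 1
  · have hps : PowerSeries.mk (flowCoeff (-t)) * (PowerSeries.mk (flowCoeff t) *
        PowerSeries.mk fun n : ℕ => fourierCoeff f n) =
        PowerSeries.mk fun n : ℕ => fourierCoeff f n := by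
      rw [← mul_assoc, h.mk_flowCoeff_neg_mul hr0, one_mul]
    have := congrArg (PowerSeries.coeff i) hps
    simpa [PowerSeries.coeff_mul, Finset.Nat.sum_antidiagonal_eq_sum_range_succ_mk] using this
  · rw [flowPerturbation, Matrix.of_apply]
    simp only [hankelMatrix, Matrix.of_apply, Finset.sum_mul, mul_assoc]
    rw [Summable.tsum_finsetSum fun k _ => ((hsum _).summable).mul_left _]
    simp only [tsum_mul_left]

/-! ### Convergence of the determinant along the flow -/

/-- The weights `(i + 1) r⁻ⁱ ∑ r⁻ˡ⁻¹` that dominate the rows of the flow perturbation. -/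
noncomputable def geomWeight (r : ℝ) (i : ℕ) : ℝ :=
  ((i : ℝ) + 1) / r ^ i * ∑' l : ℕ, 1 / r ^ (l + 1)

theorem geomWeight_nonneg {r : ℝ} (hr : 1 < r) (i : ℕ) : 0 ≤ geomWeight r i := by
  have : 0 < r := by linarith
  exact mul_nonneg (by positivity) (tsum_nonneg fun l => by positivity)

theorem summable_one_div_pow {r : ℝ} (hr : 1 < r) : Summable fun l : ℕ => 1 / r ^ (l + 1) := by
  simp only [one_div, pow_succ, mul_inv, ← inv_pow]
  exact (summable_geometric_of_lt_one (by positivity) (inv_lt_one_of_one_lt₀ hr)).mul_right _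

theorem summable_geomWeight_sq {r : ℝ} (hr : 1 < r) : Summable fun i => geomWeight r i ^ 2 := by
  have h1 : ‖(r ^ 2)⁻¹‖ < 1 := by
    rw [Real.norm_of_nonneg (by positivity)]
    exact inv_lt_one_of_one_lt₀ (one_lt_pow₀ hr two_ne_zero)
  have h2 := summable_pow_mul_geometric_of_norm_lt_one 2 h1
  have h3 := summable_pow_mul_geometric_of_norm_lt_one 1 h1
  have h4 := summable_geometric_of_norm_lt_one h1
  refine (((h2.add (h3.mul_left 2)).add h4).mul_left ((∑' l : ℕ, 1 / r ^ (l + 1)) ^ 2)).congr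
    fun i => ?_
  rw [geomWeight, mul_pow, div_pow, ← pow_mul, mul_comm i 2, pow_mul, inv_pow]
  ring

section

variable {t t' : ℕ+ → ℂ} {r R ε : ℝ} {W : Hplus →L[ℂ] L2Circle}

theorem norm_fourierCoeff_minus_le (W : Hplus →L[ℂ] L2Circle) (j l : ℕ) :
    ‖fourierCoeff (W (monomial j)) (-(l : ℤ) - 1)‖ ≤ ‖minusBlock W (monomial j)‖ := by
  rw [← inner_basisVec_projMinus]
  refine (norm_inner_le_norm _ _).trans (le_of_eq ?_)
  rw [orthonormal_basisVec.1, one_mul]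
  rfl

theorem norm_mul_fourierCoeff_le {X : Matrix ℕ ℕ ℂ} {c : ℝ}
    (hX : ∀ i l : ℕ, ‖X i l‖ ≤ c * (((i : ℝ) + 1) / r ^ i) * (1 / r ^ (l + 1))) (i j l : ℕ) :
    ‖X i l * fourierCoeff (W (monomial j)) (-(l : ℤ) - 1)‖ ≤
      c * (((i : ℝ) + 1) / r ^ i) * ‖minusBlock W (monomial j)‖ * (1 / r ^ (l + 1)) := by
  rw [norm_mul]
  refine (mul_le_mul (hX i l) (norm_fourierCoeff_minus_le W j l) (norm_nonneg _)
    ((norm_nonneg _).trans (hX i l))).trans (le_of_eq (by ring))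

theorem summable_mul_fourierCoeff (hr : 1 < r) {X : Matrix ℕ ℕ ℂ} {c : ℝ}
    (hX : ∀ i l : ℕ, ‖X i l‖ ≤ c * (((i : ℝ) + 1) / r ^ i) * (1 / r ^ (l + 1))) (i j : ℕ) :
    Summable fun l : ℕ => X i l * fourierCoeff (W (monomial j)) (-(l : ℤ) - 1) :=
  Summable.of_norm_bounded ((summable_one_div_pow hr).mul_left _)
    fun l => norm_mul_fourierCoeff_le hX i j l

theorem norm_tsum_mul_fourierCoeff_le (hr : 1 < r) {X : Matrix ℕ ℕ ℂ} {c : ℝ}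
    (hX : ∀ i l : ℕ, ‖X i l‖ ≤ c * (((i : ℝ) + 1) / r ^ i) * (1 / r ^ (l + 1))) (i j : ℕ) :
    ‖∑' l : ℕ, X i l * fourierCoeff (W (monomial j)) (-(l : ℤ) - 1)‖ ≤
      c * geomWeight r i * ‖minusBlock W (monomial j)‖ := by
  refine (tsum_of_norm_bounded ((summable_one_div_pow hr).hasSum.mul_left _)
    fun l => norm_mul_fourierCoeff_le hX i j l).trans (le_of_eq ?_)
  rw [geomWeight]
  ring

theorem FlowNormLE.norm_hankel_le (h : FlowNormLE t r R) (hr : 1 < r) (i l : ℕ) :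
    ‖hankelMatrix (flowCoeff (-t)) (flowCoeff t) i l‖ ≤
      Real.exp R ^ 2 * (((i : ℝ) + 1) / r ^ i) * (1 / r ^ (l + 1)) := by
  have hr0 : 0 < r := by linarith
  rw [sq]
  exact norm_hankelMatrix_le hr0 (h.neg.norm_flowCoeff_le hr0) (h.norm_flowCoeff_le hr0) i l

theorem FlowNormLE.norm_hankel_sub_le (h : FlowNormLE t r R) (h' : FlowNormLE t' r R)
    (hd : FlowNormLE (t' - t) r ε) (hε : ε ≤ 1) (hr : 1 < r) (i l : ℕ) :
    ‖(hankelMatrix (flowCoeff (-t')) (flowCoeff t') - hankelMatrix (flowCoeff (-t)) (flowCoeff t))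
      i l‖ ≤ (4 * ε * Real.exp R ^ 2) * (((i : ℝ) + 1) / r ^ i) * (1 / r ^ (l + 1)) := by
  have hr0 : 0 < r := by linarith
  have hd' : FlowNormLE (-t' - -t) r ε := by
    have := hd.neg
    rwa [neg_sub, sub_eq_neg_add, ← sub_neg_eq_add] at this
  have h1 := norm_hankelMatrix_le (g' := fun n => flowCoeff (-t') n - flowCoeff (-t) n) hr0
    (h.neg.norm_flowCoeff_sub_le h'.neg hd' hε hr0) (h'.norm_flowCoeff_le hr0) i l
  have h2 := norm_hankelMatrix_le (g := fun n => flowCoeff t' n - flowCoeff t n) hr0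
    (h.neg.norm_flowCoeff_le hr0) (h.norm_flowCoeff_sub_le h' hd hε hr0) i l
  have h3 : (hankelMatrix (flowCoeff (-t')) (flowCoeff t') -
      hankelMatrix (flowCoeff (-t)) (flowCoeff t)) i l =
      hankelMatrix (fun n => flowCoeff (-t') n - flowCoeff (-t) n) (flowCoeff t') i l +
        hankelMatrix (flowCoeff (-t)) (fun n => flowCoeff t' n - flowCoeff t n) i l := by
    simp only [hankelMatrix, Matrix.sub_apply, Matrix.of_apply, ← Finset.sum_sub_distrib,
      ← Finset.sum_add_distrib]
    exact Finset.sum_congr rfl fun k _ => by ring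
  rw [h3]
  refine (norm_add_le _ _).trans ((add_le_add h1 h2).trans (le_of_eq ?_))
  ring

theorem FlowNormLE.norm_flowPerturbation_sub_le (h : FlowNormLE t r R) (h' : FlowNormLE t' r R)
    (hd : FlowNormLE (t' - t) r ε) (hε : ε ≤ 1) (hr : 1 < r) (i j : ℕ) :
    ‖flowPerturbation W t' i j - flowPerturbation W t i j‖ ≤
      4 * ε * (Real.exp R ^ 2 * geomWeight r i * ‖minusBlock W (monomial j)‖) := by
  have h1 := norm_tsum_mul_fourierCoeff_le (W := W) hr (h.norm_hankel_sub_le h' hd hε hr) i j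
  simp only [Matrix.sub_apply, sub_mul] at h1
  rw [(summable_mul_fourierCoeff hr (h'.norm_hankel_le hr) i j).tsum_sub
    (summable_mul_fourierCoeff hr (h.norm_hankel_le hr) i j)] at h1
  exact h1.trans (le_of_eq (by ring))

theorem FlowNormLE.dominated_flowPerturbation (h : FlowNormLE t r R) (hr : 1 < r)
    (hW : IsHilbertSchmidt (minusBlock W)) :
    Dominated (flowPerturbation W t) (fun i => Real.exp R ^ 2 * geomWeight r i)
      (fun j => ‖minusBlock W (monomial j)‖) where
  left_nonneg i := mul_nonneg (by positivity) (geomWeight_nonneg hr i)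
  right_nonneg j := norm_nonneg _
  left_summable := by
    simp only [mul_pow]
    exact (summable_geomWeight_sq hr).mul_left _
  right_summable := hW.summable_of_orthonormal orthonormal_monomial
  bound i j := norm_tsum_mul_fourierCoeff_le hr (h.norm_hankel_le hr) i j

theorem FlowNormLE.tau_eq (h : FlowNormLE t r R) (hr : 1 < r) (W : Hplus →L[ℂ] L2Circle) :
    tau W t = infDet (1 + (opMatrix (framePerturbation W) + flowPerturbation W t)) := by
  rw [tau, infDet, infDet, funext (h.leadingMinor_flowPlusBlock hr W)]

theorem flowNormLE_zero (r : ℝ) : FlowNormLE 0 r 0 :=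
  ⟨by simp, by simp⟩

theorem flowCoeff_zero_left {n : ℕ} (hn : n ≠ 0) : flowCoeff 0 n = 0 := by
  have h1 : genFun 0 = fun z => z ^ 0 := by
    ext z
    simp [genFun]
  rw [flowCoeff, h1, taylorCoeff_pow, if_neg hn]

theorem tau_zero (W : Hplus →L[ℂ] L2Circle) :
    tau W 0 = infDet (1 + opMatrix (framePerturbation W)) := by
  rw [(flowNormLE_zero 2).tau_eq one_lt_two]
  have : flowPerturbation W 0 = 0 := by
    ext i j
    have h0 : ∀ l, hankelMatrix (flowCoeff (-0)) (flowCoeff 0) i l = 0 := fun l => by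
      rw [hankelMatrix, Matrix.of_apply]
      exact Finset.sum_eq_zero fun k _ => by
        rw [flowCoeff_zero_left (Nat.succ_ne_zero _), mul_zero]
    simp only [flowPerturbation, Matrix.of_apply, h0, zero_mul, tsum_zero, Matrix.zero_apply]
  rw [this, add_zero]

variable {w : Submodule ℂ L2Circle}

theorem IsAdmissibleFrame.tendsto_leadingMinor (hW : IsAdmissibleFrame W w)
    (hw : InGrassmannian w) (h : FlowNormLE t r R) (hr : 1 < r) :
    Tendsto (leadingMinor (flowPlusBlock W t)) atTop (𝓝 (tau W t)) := by
  obtain ⟨β, κ, hd⟩ : ∃ β κ, Dominated (opMatrix (framePerturbation W)) β κ :=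
    hW.traceClass.exists_dominated
  have := (hd.add (h.dominated_flowPerturbation hr
    (hW.isHilbertSchmidt_minusBlock hw))).tendsto_infDet
  rwa [h.tau_eq hr, funext (h.leadingMinor_flowPlusBlock hr W)]

/-- The tau function is locally Lipschitz in the weighted `ℓ¹` norm. -/
theorem IsAdmissibleFrame.exists_norm_tau_sub_le (hW : IsAdmissibleFrame W w)
    (hw : InGrassmannian w) (hr : 1 < r) (R : ℝ) :
    ∃ C : ℝ, 0 ≤ C ∧ ∀ (t t' : ℕ+ → ℂ) (ε : ℝ), FlowNormLE t r R → FlowNormLE t' r R →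
      FlowNormLE (t' - t) r ε → 0 < ε → ε ≤ 1 / 8 → ‖tau W t' - tau W t‖ ≤ C * ε := by
  obtain ⟨β, κ, hd⟩ : ∃ β κ, Dominated (opMatrix (framePerturbation W)) β κ :=
    hW.traceClass.exists_dominated
  have hHS := hW.isHilbertSchmidt_minusBlock hw
  set b := fun i => β i + Real.exp R ^ 2 * geomWeight r i with hb
  set k := fun j => κ j + ‖minusBlock W (monomial j)‖ with hk
  refine ⟨8 * detBound (∑' i, b i ^ 2) (2 * (∑' i, k i ^ 2) + 2 * (∑' i, k i ^ 2)),
    by have := detBound_pos (∑' i, b i ^ 2) (2 * (∑' i, k i ^ 2) + 2 * (∑' i, k i ^ 2)); positivity,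
    fun t t' ε h h' hε hε0 hε1 => ?_⟩
  have h1 := hd.add (h.dominated_flowPerturbation hr hHS)
  have h2 := hd.add (h'.dominated_flowPerturbation hr hHS)
  rw [h.tau_eq hr, h'.tau_eq hr]
  refine (h1.norm_infDet_sub_le h2 (δ := 4 * ε) (by positivity) (by linarith)
    fun i j => ?_).trans (le_of_eq (by ring))
  rw [Matrix.add_apply, Matrix.add_apply, add_sub_add_left_eq_sub]
  refine (h.norm_flowPerturbation_sub_le h' hε (by linarith) hr i j).trans ?_
  have hg := geomWeight_nonneg hr i
  gcongr
  · exact add_nonneg (hd.left_nonneg i) (mul_nonneg (by positivity) hg)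
  · exact le_add_of_nonneg_left (hd.left_nonneg i)
  · exact le_add_of_nonneg_left (hd.right_nonneg j)

end

/-! ### Uniform limits of holomorphic functions on normed spaces -/

section UniformLimit

variable {E G : Type} [NormedAddCommGroup E] [NormedSpace ℂ E]

/-- Cauchy's estimate for the Fréchet derivative. -/
theorem norm_fderiv_le_of_forall_closedBall [NormedAddCommGroup G] [NormedSpace ℂ G] {f : E → G}
    (hf : Differentiable ℂ f) {x : E} {ε : ℝ} (hε : 0 ≤ ε)
    (h : ∀ y ∈ Metric.closedBall x 1, ‖f y‖ ≤ ε) : ‖fderiv ℂ f x‖ ≤ ε := by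
  refine ContinuousLinearMap.opNorm_le_bound _ hε fun v => ?_
  rcases eq_or_ne v 0 with rfl | hv
  · simp
  have hv' : 0 < ‖v‖ := norm_pos_iff.2 hv
  have hline : ∀ z : ℂ, HasDerivAt (fun z : ℂ => x + z • v) v z := fun z => by
    simpa using ((hasDerivAt_id z).smul_const v).const_add x
  have hder : HasDerivAt (fun z : ℂ => f (x + z • v)) (fderiv ℂ f x v) 0 := by
    have h1 : HasFDerivAt f (fderiv ℂ f x) (x + (0 : ℂ) • v) := by
      simpa using (hf x).hasFDerivAt
    exact h1.comp_hasDerivAt (0 : ℂ) (hline 0)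
  have hd : Differentiable ℂ fun z : ℂ => f (x + z • v) := fun z =>
    ((hf _).hasFDerivAt.comp_hasDerivAt z (hline z)).differentiableAt
  rw [← hder.deriv]
  refine (Complex.norm_deriv_le_of_forall_mem_sphere_norm_le (R := 1 / ‖v‖) (C := ε)
    (by positivity) hd.diffContOnCl fun z hz => h _ ?_).trans (le_of_eq (by field_simp))
  rw [mem_sphere_zero_iff_norm] at hz
  rw [Metric.mem_closedBall, dist_eq_norm, add_sub_cancel_left, norm_smul, hz]
  exact le_of_eq (by field_simp)

/-- A limit of holomorphic functions that is uniform on balls is smooth: by Cauchy's estimate the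
derivatives again converge uniformly on balls. -/
theorem contDiff_of_tendstoUniformlyOn_closedBall (n : ℕ) :
    ∀ {G : Type} [NormedAddCommGroup G] [NormedSpace ℂ G] [CompleteSpace G] {f : ℕ → E → G}
      {g : E → G}, (∀ N, ContDiff ℂ ∞ (f N)) →
      (∀ R : ℝ, TendstoUniformlyOn f g atTop (Metric.closedBall 0 R)) → ContDiff ℂ n g := by
  induction n with
  | zero =>
    intro G _ _ _ f g hf hfg
    refine contDiff_zero.2 (continuous_iff_continuousAt.2 fun x => ?_)
    refine ((hfg (‖x‖ + 1)).continuousOn (.of_forall fun N =>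
      (hf N).continuous.continuousOn)).continuousAt ?_
    exact Filter.mem_of_superset (Metric.closedBall_mem_nhds x one_pos)
      (Metric.closedBall_subset_closedBall' (by rw [dist_zero_right, add_comm]))
  | succ n ih =>
    intro G _ _ _ f g hf hfg
    have hdiff : ∀ N, Differentiable ℂ (f N) := fun N => (hf N).differentiable (by simp)
    have hcauchy : ∀ R : ℝ, UniformCauchySeqOn (fun N => fderiv ℂ (f N)) atTop
        (Metric.closedBall 0 R) := by
      intro R
      rw [Metric.uniformCauchySeqOn_iff]
      intro ε hε
      obtain ⟨N₀, hN₀⟩ := Metric.uniformCauchySeqOn_iff.1 (hfg (R + 1)).uniformCauchySeqOn (ε / 2)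
        (half_pos hε)
      refine ⟨N₀, fun m hm k hk x hx => ?_⟩
      rw [dist_eq_norm, ← fderiv_sub (hdiff m x) (hdiff k x)]
      refine (norm_fderiv_le_of_forall_closedBall ((hdiff m).sub (hdiff k)) (half_pos hε).le
        fun y hy => ?_).trans_lt (half_lt_self hε)
      rw [Pi.sub_apply, ← dist_eq_norm]
      refine (hN₀ m hm k hk y ?_).le
      rw [mem_closedBall_zero_iff] at hx ⊢
      rw [Metric.mem_closedBall, dist_eq_norm] at hy
      calc ‖y‖ = ‖x + (y - x)‖ := by congr 1; abel
        _ ≤ ‖x‖ + ‖y - x‖ := norm_add_le _ _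
        _ ≤ R + 1 := add_le_add hx hy
    have hlim : ∀ x, ∃ l, Tendsto (fun N => fderiv ℂ (f N) x) atTop (𝓝 l) := fun x =>
      cauchySeq_tendsto_of_complete ((hcauchy ‖x‖).cauchySeq (by simp))
    choose g' hg' using hlim
    have hunif : ∀ R : ℝ, TendstoUniformlyOn (fun N => fderiv ℂ (f N)) g' atTop
        (Metric.closedBall 0 R) := fun R =>
      (hcauchy R).tendstoUniformlyOn_of_tendsto fun x _ => hg' x
    have hderiv : ∀ x, HasFDerivAt g (g' x) x := fun x =>
      hasFDerivAt_of_tendstoUniformlyOn (s := Metric.ball 0 (‖x‖ + 1)) Metric.isOpen_ball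
        ((hunif (‖x‖ + 1)).mono Metric.ball_subset_closedBall)
        (fun N y _ => (hdiff N y).hasFDerivAt)
        (fun y _ => (hfg ‖y‖).tendsto_at (by simp)) (by simp)
    have hfd : fderiv ℂ g = g' := funext fun x => (hderiv x).fderiv
    rw [Nat.cast_add, Nat.cast_one, contDiff_succ_iff_fderiv]
    refine ⟨fun x => (hderiv x).differentiableAt, by simp, ?_⟩
    rw [hfd]
    exact ih (fun N => (hf N).fderiv_right (by simp)) hunif

end UniformLimit

/-! ### Smoothness of the tau function in finitely many variables -/

section Smooth

variable {ι : Type} [Fintype ι]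

/-- The functional `g ↦ ∫ g f z⁻ᵐ` on continuous functions. -/
noncomputable def fourierFunctional (f : L2Circle) (m : ℤ) : C(AddCircle (1 : ℝ), ℂ) →L[ℂ] ℂ :=
  LinearMap.mkContinuous
    { toFun := fun g => fourierCoeff (fun x => g x * f x) m
      map_add' := fun g g' => by
        have h : ∀ g : C(AddCircle (1 : ℝ), ℂ),
            Integrable (fun x => g x * f x) (AddCircle.haarAddCircle (T := (1 : ℝ))) := fun g =>
          (integrable_L2Circle f).bdd_mul g.continuous.aestronglyMeasurable
            (.of_forall fun x => g.norm_coe_le_norm x)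
        have h2 := congrFun (fourierCoeff.add (h g) (h g')) m
        refine Eq.trans ?_ h2
        congr 1
        ext x
        exact add_mul _ _ _
      map_smul' := fun c g => by
        simp only [RingHom.id_apply, smul_eq_mul]
        rw [← fourierCoeff.const_mul]
        congr 1
        ext x
        simp [mul_assoc] }
    (∫ x, ‖f x‖ ∂(AddCircle.haarAddCircle (T := (1 : ℝ)))) fun g => by
      simp only [LinearMap.coe_mk, AddHom.coe_mk]
      refine (norm_integral_le_integral_norm _).trans ?_
      rw [mul_comm, ← integral_const_mul]
      refine integral_mono_of_nonneg (.of_forall fun x => norm_nonneg _)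
        ((integrable_L2Circle f).norm.const_mul _) (.of_forall fun x => ?_)
      simp only [norm_smul, norm_mul, norm_fourier_apply, one_mul]
      gcongr
      exact g.norm_coe_le_norm x

theorem fourierFunctional_apply (f : L2Circle) (m : ℤ) (g : C(AddCircle (1 : ℝ), ℂ)) :
    fourierFunctional f m g = fourierCoeff (fun x => g x * f x) m := rfl

/-- The exponent `∑ t_i z ^ i` for finitely many nonzero `t_i`, as a continuous function. -/
noncomputable def flowExponent (t : ℕ+ →₀ ℂ) : C(AddCircle (1 : ℝ), ℂ) :=
  t.sum fun i c => c • fourier (i : ℤ)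

theorem flow_eq_exp_flowExponent (t : ℕ+ →₀ ℂ) (x : AddCircle (1 : ℝ)) :
    flow t x = NormedSpace.exp (flowExponent t) x := by
  have h := NormedSpace.map_exp (ContinuousMap.evalAlgHom ℂ ℂ x)
    (continuous_eval_const x) (flowExponent t)
  have h' : NormedSpace.exp (flowExponent t) x = NormedSpace.exp (flowExponent t x) := h
  rw [h', flow, ← Complex.exp_eq_exp_ℂ, flowExponent, Finsupp.sum, ContinuousMap.sum_apply,
    tsum_eq_sum (s := t.support)]
  · rfl
  · intro i hi
    rw [Finsupp.notMem_support_iff.1 hi, zero_mul]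

theorem flowExponent_sum (v : ι → ℕ+ →₀ ℂ) (s : ι → ℂ) :
    flowExponent (∑ k, s k • v k) = ∑ k, s k • flowExponent (v k) := by
  have hlin : flowExponent = Finsupp.linearCombination ℂ
      fun i : ℕ+ => (fourier (i : ℤ) : C(AddCircle (1 : ℝ), ℂ)) := rfl
  rw [hlin, map_sum]
  simp only [map_smul]

theorem contDiff_flowPlusBlock (W : Hplus →L[ℂ] L2Circle) (v : ι → ℕ+ →₀ ℂ) (i j : ℕ) :
    ContDiff ℂ ∞ fun s : ι → ℂ => flowPlusBlock W (⇑(∑ k, s k • v k)) i j := by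
  have h : (fun s : ι → ℂ => flowPlusBlock W (⇑(∑ k, s k • v k)) i j) = fun s =>
      fourierFunctional (W (monomial j)) (-(-(i : ℤ) - 1) - 1)
        (NormedSpace.exp (∑ k, s k • flowExponent (v k))) := by
    ext s
    rw [fourierFunctional_apply, ← flowExponent_sum]
    simp only [← flow_eq_exp_flowExponent]
    rfl
  rw [h]
  have hexp : ContDiff ℂ ∞ (NormedSpace.exp : C(AddCircle (1 : ℝ), ℂ) → _) :=
    contDiff_iff_contDiffAt.2 fun x => (NormedSpace.exp_analytic (𝕂 := ℂ) x).contDiffAt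
  exact (fourierFunctional _ _).contDiff.comp (hexp.comp (by fun_prop))

theorem contDiff_leadingMinor (W : Hplus →L[ℂ] L2Circle) (v : ι → ℕ+ →₀ ℂ) (N : ℕ) :
    ContDiff ℂ ∞ fun s : ι → ℂ => leadingMinor (flowPlusBlock W (⇑(∑ k, s k • v k))) N := by
  have := contDiff_flowPlusBlock W v
  simp only [leadingMinor, Matrix.det_apply, Matrix.submatrix_apply]
  fun_prop

theorem exists_flowNormLE_of_closedBall (v : ι → ℕ+ →₀ ℂ) {r : ℝ} (hr : 0 ≤ r) (R : ℝ) :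
    ∃ C : ℝ, ∀ s ∈ Metric.closedBall (0 : ι → ℂ) R, FlowNormLE (⇑(∑ k, s k • v k)) r C := by
  set F : Finset ℕ+ := Finset.univ.biUnion fun k => (v k).support with hF
  refine ⟨∑ i ∈ F, (∑ k, R * ‖v k i‖) * r ^ (i : ℕ), fun s hs => ?_⟩
  rw [mem_closedBall_zero_iff] at hs
  have hzero : ∀ i ∉ F, ‖(∑ k, s k • v k) i‖ * r ^ (i : ℕ) = 0 := fun i hi => by
    have h0 : ∀ k, v k i = 0 := fun k => by
      by_contra h
      exact hi (Finset.mem_biUnion.2 ⟨k, Finset.mem_univ k, Finsupp.mem_support_iff.2 h⟩)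
    rw [Finsupp.finsetSum_apply, Finset.sum_eq_zero fun k _ => by simp [h0 k], norm_zero, zero_mul]
  refine ⟨summable_of_ne_finset_zero (s := F) hzero, ?_⟩
  rw [tsum_eq_sum hzero]
  refine Finset.sum_le_sum fun i _ => ?_
  gcongr
  rw [Finsupp.finsetSum_apply]
  refine (norm_sum_le _ _).trans (Finset.sum_le_sum fun k _ => ?_)
  rw [Finsupp.smul_apply, norm_smul]
  gcongr
  exact (norm_le_pi_norm s k).trans hs

variable {w : Submodule ℂ L2Circle} {W : Hplus →L[ℂ] L2Circle}

theorem IsAdmissibleFrame.contDiff_tau (hW : IsAdmissibleFrame W w) (hw : InGrassmannian w)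
    (v : ι → ℕ+ →₀ ℂ) : ContDiff ℂ ∞ fun s : ι → ℂ => tau W (⇑(∑ k, s k • v k)) := by
  refine contDiff_infty.2 fun n => contDiff_of_tendstoUniformlyOn_closedBall n
    (fun N => contDiff_leadingMinor W v N) fun R => ?_
  obtain ⟨C, hC⟩ := exists_flowNormLE_of_closedBall v zero_le_two R
  obtain ⟨β, κ, hd⟩ : ∃ β κ, Dominated (opMatrix (framePerturbation W)) β κ :=
    hW.traceClass.exists_dominated
  have hHS := hW.isHilbertSchmidt_minusBlock hw
  refine UniformCauchySeqOn.tendstoUniformlyOn_of_tendsto ?_ fun s hs =>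
    hW.tendsto_leadingMinor hw (hC s hs) one_lt_two
  rw [Metric.uniformCauchySeqOn_iff]
  intro ε hε
  obtain ⟨N₀, hN₀⟩ := exists_forall_norm_leadingMinor_sub_lt
    (fun j => κ j + ‖minusBlock W (monomial j)‖)
    (∑' i, (β i + Real.exp C ^ 2 * geomWeight 2 i) ^ 2) hε
  refine ⟨N₀, fun m hm n hn s hs => ?_⟩
  rw [dist_eq_norm, (hC s hs).leadingMinor_flowPlusBlock one_lt_two,
    (hC s hs).leadingMinor_flowPlusBlock one_lt_two]
  exact hN₀ _ _ (hd.add ((hC s hs).dominated_flowPerturbation one_lt_two hHS)) le_rfl n hn m hm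

end Smooth

/-! ### Functions that are smooth in finitely many variables -/

/-- Smoothness along every finite-dimensional family of flow parameters with finitely many nonzero
entries. -/
def FinitelySmooth (f : (ℕ+ → ℂ) → ℂ) : Prop :=
  ∀ (ι : Type) [Fintype ι] (v : ι → ℕ+ →₀ ℂ),
    ContDiff ℂ ∞ fun s : ι → ℂ => f (⇑(∑ k, s k • v k))

/-- Equality at the flow parameters with finitely many nonzero entries. -/
def FinEq (f g : (ℕ+ → ℂ) → ℂ) : Prop := ∀ t : ℕ+ →₀ ℂ, f t = g t

theorem FinEq.trans {f g h : (ℕ+ → ℂ) → ℂ} (h1 : FinEq f g) (h2 : FinEq g h) : FinEq f h :=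
  fun t => (h1 t).trans (h2 t)

theorem FinEq.refl (f : (ℕ+ → ℂ) → ℂ) : FinEq f f := fun _ => rfl

section

variable {f g : (ℕ+ → ℂ) → ℂ} {ι : Type} [Fintype ι]

theorem FinitelySmooth.lineDeriv_eq (hf : FinitelySmooth f) [DecidableEq ι] (v : ι → ℕ+ →₀ ℂ)
    (s : ι → ℂ) (k : ι) :
    lineDeriv ℂ f (⇑(∑ k, s k • v k)) (⇑(v k)) =
      fderiv ℂ (fun s : ι → ℂ => f (⇑(∑ k, s k • v k))) s (Pi.single k 1) := by
  rw [← (((hf ι v).differentiable (by simp)) s).lineDeriv_eq_fderiv, lineDeriv, lineDeriv]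
  congr 1
  ext z
  congr 1
  rw [← Finsupp.coe_smul, ← Finsupp.coe_add]
  congr 1
  simp only [Pi.add_apply, Pi.smul_apply, smul_eq_mul, add_smul, Finset.sum_add_distrib]
  congr 1
  rw [Finset.sum_eq_single k]
  · simp
  · intro b _ hb
    simp [Pi.single_eq_of_ne hb]
  · simp

theorem FinitelySmooth.scaledPartial (hf : FinitelySmooth f) (ε : ℂ) (i : ℕ+) :
    FinitelySmooth (scaledPartial ε i f) := by
  classical
  intro ι _ v
  set v' : Option ι → ℕ+ →₀ ℂ := fun o => o.elim (Finsupp.single i 1) v with hv'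
  have hF := hf (Option ι) v'
  have h : (fun s : ι → ℂ => KPTau.scaledPartial ε i f (⇑(∑ k, s k • v k))) = fun s =>
      ε / ((i : ℕ) : ℂ) * fderiv ℂ (fun s : Option ι → ℂ => f (⇑(∑ k, s k • v' k)))
        (fun o => o.elim 0 s) (Pi.single none 1) := by
    ext s
    rw [← hf.lineDeriv_eq v' _ none, KPTau.scaledPartial]
    simp [hv', Fintype.sum_option, Finsupp.single_eq_pi_single]
  rw [h]
  have h1 : ContDiff ℂ ∞ fun s : ι → ℂ => (fun o => o.elim 0 s : Option ι → ℂ) := by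
    refine contDiff_pi.2 fun o => ?_
    cases o
    · exact contDiff_const
    · exact contDiff_apply ℂ ℂ _
  exact contDiff_const.mul (((hF.fderiv_right (m := ∞) (by simp)).comp h1).clm_apply contDiff_const)

theorem FinEq.scaledPartial (h : FinEq f g) (ε : ℂ) (i : ℕ+) :
    FinEq (scaledPartial ε i f) (scaledPartial ε i g) := by
  intro t
  rw [KPTau.scaledPartial, KPTau.scaledPartial, lineDeriv, lineDeriv]
  congr 3
  ext z
  have : (t : ℕ+ → ℂ) + z • Pi.single i 1 = ⇑(t + z • Finsupp.single i (1 : ℂ)) := by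
    rw [Finsupp.coe_add, Finsupp.coe_smul, Finsupp.single_eq_pi_single]
  rw [this]
  exact h _

theorem FinitelySmooth.scaledPartial_comm (hf : FinitelySmooth f) (ε : ℂ) (i j : ℕ+) :
    FinEq (KPTau.scaledPartial ε i (KPTau.scaledPartial ε j f))
      (KPTau.scaledPartial ε j (KPTau.scaledPartial ε i f)) := by
  intro t
  set v : Fin 3 → ℕ+ →₀ ℂ := ![t, Finsupp.single i 1, Finsupp.single j 1] with hv
  set F : (Fin 3 → ℂ) → ℂ := fun s => f (⇑(∑ k, s k • v k)) with hF
  have hFs : ContDiff ℂ ∞ F := hf (Fin 3) v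
  have hFd : Differentiable ℂ (fderiv ℂ F) :=
    (hFs.fderiv_right (m := ∞) (by simp)).differentiable (by simp)
  have ht : t = ∑ k, (Pi.single 0 1 : Fin 3 → ℂ) k • v k := by
    simp [hv]
  have hmain : ∀ k l : Fin 3, ∀ a b : ℕ+, v k = Finsupp.single a 1 → v l = Finsupp.single b 1 →
      KPTau.scaledPartial ε a (KPTau.scaledPartial ε b f) t = ε / ((a : ℕ) : ℂ) *
        (ε / ((b : ℕ) : ℂ) * fderiv ℂ (fderiv ℂ F) (Pi.single 0 1) (Pi.single k 1)
          (Pi.single l 1)) := by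
    intro k l a b hk hl
    have h1 : ∀ s : Fin 3 → ℂ, KPTau.scaledPartial ε b f (⇑(∑ k, s k • v k)) =
        ε / ((b : ℕ) : ℂ) * fderiv ℂ F s (Pi.single l 1) := fun s => by
      rw [KPTau.scaledPartial, hF, ← hf.lineDeriv_eq v s l, hl, Finsupp.single_eq_pi_single]
    have h2 := (hf.scaledPartial ε b).lineDeriv_eq v (Pi.single 0 1) k
    rw [← ht, hk] at h2
    rw [KPTau.scaledPartial, ← Finsupp.single_eq_pi_single, h2]
    simp only [h1]
    rw [fderiv_const_mul (by fun_prop), fderiv_clm_apply (by fun_prop) (by fun_prop)]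
    simp
  rw [hmain 1 2 i j rfl rfl, hmain 2 1 j i rfl rfl]
  have hsymm : IsSymmSndFDerivAt ℂ F (Pi.single 0 1) :=
    by
    have h2 : ContDiff ℂ (2 : ℕ) F := contDiff_infty.1 hFs 2
    exact h2.contDiffAt.isSymmSndFDerivAt (by simp)
  rw [hsymm.eq]
  ring

end

/-! ### Constant coefficient differential operators -/

section

variable {f g : (ℕ+ → ℂ) → ℂ} (ε : ℂ)

theorem FinitelySmooth.iterate (hf : FinitelySmooth f) (i : ℕ+) (n : ℕ) :
    FinitelySmooth ((KPTau.scaledPartial ε i)^[n] f) := by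
  induction n with
  | zero => exact hf
  | succ n ih =>
    rw [Function.iterate_succ_apply']
    exact ih.scaledPartial ε i

theorem FinEq.iterate (h : FinEq f g) (i : ℕ+) (n : ℕ) :
    FinEq ((KPTau.scaledPartial ε i)^[n] f) ((KPTau.scaledPartial ε i)^[n] g) := by
  induction n with
  | zero => exact h
  | succ n ih =>
    rw [Function.iterate_succ_apply', Function.iterate_succ_apply']
    exact ih.scaledPartial ε i

theorem FinitelySmooth.scaledPartial_iterate_comm (hf : FinitelySmooth f) (i j : ℕ+) (n : ℕ) :
    FinEq (KPTau.scaledPartial ε i ((KPTau.scaledPartial ε j)^[n] f))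
      ((KPTau.scaledPartial ε j)^[n] (KPTau.scaledPartial ε i f)) := by
  induction n with
  | zero => exact .refl _
  | succ n ih =>
    rw [Function.iterate_succ_apply', Function.iterate_succ_apply']
    exact ((hf.iterate ε j n).scaledPartial_comm ε i j).trans (ih.scaledPartial ε j)

/-- The composite of the `m i`-th powers of the operators `(ε / i) ∂/∂t_i` along a list. -/
noncomputable def partialFold (L : List ℕ+) (m : ℕ+ →₀ ℕ) (f : (ℕ+ → ℂ) → ℂ) : (ℕ+ → ℂ) → ℂ :=
  L.foldr (fun i g => (KPTau.scaledPartial ε i)^[m i] g) f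

theorem FinitelySmooth.partialFold (hf : FinitelySmooth f) (L : List ℕ+) (m : ℕ+ →₀ ℕ) :
    FinitelySmooth (partialFold ε L m f) := by
  induction L with
  | nil => exact hf
  | cons a L ih => exact ih.iterate ε a (m a)

theorem FinitelySmooth.scaledPartial_partialFold (hf : FinitelySmooth f) (i : ℕ+) (L : List ℕ+)
    (m : ℕ+ →₀ ℕ) :
    FinEq (KPTau.scaledPartial ε i (KPTau.partialFold ε L m f))
      (KPTau.partialFold ε L m (KPTau.scaledPartial ε i f)) := by
  induction L with
  | nil => exact .refl _
  | cons a L ih =>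
    exact ((hf.partialFold ε L m).scaledPartial_iterate_comm ε i a (m a)).trans
      (ih.iterate ε a (m a))

theorem partialFold_congr {L : List ℕ+} {m m' : ℕ+ →₀ ℕ} (h : ∀ i ∈ L, m i = m' i)
    (f : (ℕ+ → ℂ) → ℂ) : partialFold ε L m f = partialFold ε L m' f := by
  induction L with
  | nil => rfl
  | cons a L ih =>
    have ih' := ih fun i hi => h i (List.mem_cons_of_mem _ hi)
    simp only [partialFold, List.foldr_cons] at ih' ⊢
    rw [ih', h a List.mem_cons_self]

theorem FinitelySmooth.partialFold_add_single (hf : FinitelySmooth f) {i : ℕ+} {L : List ℕ+}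
    (hL : L.Nodup) (hi : i ∈ L) (m : ℕ+ →₀ ℕ) :
    FinEq (KPTau.partialFold ε L (m + Finsupp.single i 1) f)
      (KPTau.partialFold ε L m (KPTau.scaledPartial ε i f)) := by
  induction L with
  | nil => simp at hi
  | cons a L ih =>
    obtain ⟨ha, hL'⟩ := List.nodup_cons.1 hL
    change FinEq ((KPTau.scaledPartial ε a)^[(m + Finsupp.single i 1 : ℕ+ →₀ ℕ) a]
      (KPTau.partialFold ε L (m + Finsupp.single i 1) f)) ((KPTau.scaledPartial ε a)^[m a]
        (KPTau.partialFold ε L m (KPTau.scaledPartial ε i f)))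
    rcases eq_or_ne a i with rfl | hne
    · have h1 : KPTau.partialFold ε L (m + Finsupp.single a 1) f = KPTau.partialFold ε L m f :=
        partialFold_congr ε (fun b hb => by
          have : a ≠ b := fun h => ha (h ▸ hb)
          simp [this]) f
      rw [h1, Finsupp.add_apply, Finsupp.single_eq_same, Function.iterate_succ_apply]
      exact (hf.scaledPartial_partialFold ε a L m).iterate ε a (m a)
    · have h1 : (m + Finsupp.single i 1 : ℕ+ →₀ ℕ) a = m a := by
        simp [hne.symm]
      rw [h1]
      exact (ih hL' (List.mem_of_ne_of_mem hne.symm hi)).iterate ε a (m a)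

theorem partialFold_filter (L : List ℕ+) (m : ℕ+ →₀ ℕ) (f : (ℕ+ → ℂ) → ℂ) :
    partialFold ε (L.filter (· ∈ m.support)) m f = partialFold ε L m f := by
  induction L with
  | nil => rfl
  | cons a L ih =>
    by_cases h : a ∈ m.support
    · rw [List.filter_cons_of_pos (by simpa using h)]
      exact congrArg (KPTau.scaledPartial ε a)^[m a] ih
    · rw [List.filter_cons_of_neg (by simpa using h), ih]
      simp [partialFold, Finsupp.notMem_support_iff.1 h]

/-- The list of variables may be enlarged beyond the support of the exponent; this lets monomials
with different supports be compared. -/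
theorem scaledPartialMonomial_eq_partialFold {m : ℕ+ →₀ ℕ} {F : Finset ℕ+} (hF : m.support ⊆ F)
    (f : (ℕ+ → ℂ) → ℂ) :
    scaledPartialMonomial ε m f = partialFold ε (F.sort (· ≤ ·)) m f := by
  rw [← partialFold_filter]
  have : (F.sort (· ≤ ·)).filter (· ∈ m.support) = m.support.sort (· ≤ ·) := by
    refine List.Perm.eq_of_pairwise (le := (· ≤ ·)) (fun a b _ _ => le_antisymm)
      ((F.pairwise_sort (· ≤ ·)).filter _) (m.support.pairwise_sort (· ≤ ·)) ?_
    refine (List.perm_ext_iff_of_nodup ((F.sort_nodup _).filter _) (m.support.sort_nodup _)).2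
      fun a => ?_
    simp only [List.mem_filter, Finset.mem_sort, decide_eq_true_eq]
    exact ⟨fun h => h.2, fun h => ⟨hF h, h⟩⟩
  rw [this]
  rfl

theorem FinitelySmooth.scaledPartialMonomial_add_single (hf : FinitelySmooth f) (i : ℕ+)
    (m : ℕ+ →₀ ℕ) :
    FinEq (scaledPartialMonomial ε (m + Finsupp.single i 1) f)
      (scaledPartialMonomial ε m (KPTau.scaledPartial ε i f)) := by
  rw [scaledPartialMonomial_eq_partialFold ε (F := insert i m.support)
      (Finsupp.support_add.trans (Finset.union_subset (Finset.subset_insert _ _)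
        (Finsupp.support_single_subset.trans (by simp)))),
    scaledPartialMonomial_eq_partialFold ε (Finset.subset_insert i m.support)]
  exact hf.partialFold_add_single ε (Finset.sort_nodup _ _) (by simp) m

/-- `p ↦ p(ε ∂_t) f (t)` as a linear functional. -/
noncomputable def diffOpFunctional (f : (ℕ+ → ℂ) → ℂ) (t : ℕ+ → ℂ) : MvPolynomial ℕ+ ℂ →ₗ[ℂ] ℂ :=
  (MvPolynomial.basisMonomials ℕ+ ℂ).constr ℂ fun m => scaledPartialMonomial ε m f t

theorem diffOpFunctional_apply (f : (ℕ+ → ℂ) → ℂ) (t : ℕ+ → ℂ) (p : MvPolynomial ℕ+ ℂ) :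
    diffOpFunctional ε f t p = diffOp ε p f t := by
  rw [diffOpFunctional, Module.Basis.constr_apply]
  rfl

theorem diffOpFunctional_monomial (f : (ℕ+ → ℂ) → ℂ) (t : ℕ+ → ℂ) (m : ℕ+ →₀ ℕ) :
    diffOpFunctional ε f t (MvPolynomial.monomial m 1) = scaledPartialMonomial ε m f t := by
  have := (MvPolynomial.basisMonomials ℕ+ ℂ).constr_basis ℂ
    (fun m => scaledPartialMonomial ε m f t) m
  rwa [MvPolynomial.coe_basisMonomials] at this

theorem FinitelySmooth.diffOp_X_mul (hf : FinitelySmooth f) (i : ℕ+) (p : MvPolynomial ℕ+ ℂ)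
    (t : ℕ+ →₀ ℂ) :
    diffOp ε (MvPolynomial.X i * p) f t = diffOp ε p (KPTau.scaledPartial ε i f) t := by
  have h : diffOpFunctional ε f t ∘ₗ LinearMap.mulLeft ℂ (MvPolynomial.X i) =
      diffOpFunctional ε (KPTau.scaledPartial ε i f) t := by
    refine (MvPolynomial.basisMonomials ℕ+ ℂ).ext fun m => ?_
    rw [MvPolynomial.coe_basisMonomials, diffOpFunctional_monomial, LinearMap.comp_apply,
      LinearMap.mulLeft_apply, MvPolynomial.X, MvPolynomial.monomial_mul, one_mul, add_comm,
      diffOpFunctional_monomial]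
    exact hf.scaledPartialMonomial_add_single ε i m t
  have := LinearMap.congr_fun h p
  rwa [LinearMap.comp_apply, LinearMap.mulLeft_apply, diffOpFunctional_apply,
    diffOpFunctional_apply] at this

theorem FinitelySmooth.diffOp (hf : FinitelySmooth f) (p : MvPolynomial ℕ+ ℂ) :
    FinitelySmooth (diffOp ε p f) := by
  intro ι _ v
  simp only [KPTau.diffOp]
  exact ContDiff.sum fun m _ => contDiff_const.mul (hf.partialFold ε _ m ι v)

theorem diffOp_one (f : (ℕ+ → ℂ) → ℂ) (t : ℕ+ → ℂ) : diffOp ε 1 f t = f t := by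
  rw [← diffOpFunctional_apply, ← MvPolynomial.C_1, ← MvPolynomial.monomial_zero',
    diffOpFunctional_monomial]
  simp [scaledPartialMonomial]

/-! ### The complete symmetric functions as differential operators -/

/-- The generating series `∑ t_i z ^ i` has no constant term. -/
theorem hasSubst_flowSeries : PowerSeries.HasSubst (PowerSeries.mk fun n : ℕ =>
    if hn : 0 < n then (MvPolynomial.X (n.toPNat hn) : MvPolynomial ℕ+ ℂ) else 0) :=
  PowerSeries.HasSubst.of_constantCoeff_zero' (by simp)

theorem completeSymm_zero : completeSymm 0 = 1 := by
  rw [completeSymm, PowerSeries.coeff_subst' hasSubst_flowSeries, finsum_eq_single _ 0]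
  · simp
  · intro d hd
    simp [hd]

/-- Newton's recursion `(k + 1) h_{k+1} = ∑ (j + 1) t_{j+1} h_{k-j}`, the logarithmic derivative of
the generating function. -/
theorem completeSymm_succ (k : ℕ) :
    ((k : ℂ) + 1) • completeSymm (k + 1) = ∑ j ∈ Finset.range (k + 1),
      ((j : ℂ) + 1) • (MvPolynomial.X j.succPNat * completeSymm (k - j)) := by
  have h := congrArg (PowerSeries.coeff k) (PowerSeries.derivative_subst
    (f := PowerSeries.exp (MvPolynomial ℕ+ ℂ)) hasSubst_flowSeries)
  rw [PowerSeries.derivative_exp, mul_comm, PowerSeries.coeff_mul,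
    Finset.Nat.sum_antidiagonal_eq_sum_range_succ_mk, PowerSeries.coeff_derivative] at h
  have hC : ∀ (n : ℕ) (p : MvPolynomial ℕ+ ℂ),
      ((n : ℂ) + 1) • p = p * ((n : MvPolynomial ℕ+ ℂ) + 1) := fun n p => by
      rw [MvPolynomial.smul_eq_C_mul, mul_comm]
      simp
  simp only [hC]
  refine h.trans (Finset.sum_congr rfl fun j _ => ?_)
  rw [PowerSeries.coeff_derivative, PowerSeries.coeff_mk, dif_pos j.succ_pos]
  change MvPolynomial.X j.succPNat * _ * completeSymm (k - j) = _
  ring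

theorem FinitelySmooth.diffOp_completeSymm_succ (hf : FinitelySmooth f) (k : ℕ) (t : ℕ+ →₀ ℂ) :
    ((k : ℂ) + 1) * KPTau.diffOp ε (completeSymm (k + 1)) f t = ∑ j ∈ Finset.range (k + 1),
      ((j : ℂ) + 1) *
        KPTau.diffOp ε (completeSymm (k - j)) (KPTau.scaledPartial ε j.succPNat f) t := by
  have h := congrArg (diffOpFunctional ε f t) (completeSymm_succ k)
  rw [map_smul, map_sum] at h
  simp only [map_smul, diffOpFunctional_apply, smul_eq_mul, hf.diffOp_X_mul] at h
  exact h

/-- The point `(x, x² / 2, …, x ^ K / K, 0, …)`. -/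
noncomputable def powVec (K : ℕ) (x : ℂ) : ℕ+ →₀ ℂ :=
  ∑ j : Fin K, (x ^ ((j : ℕ) + 1) / (((j : ℕ) : ℂ) + 1)) • Finsupp.single (j : ℕ).succPNat (1 : ℂ)

/-- The family of directions spanned by `t` and the first `K` coordinate vectors. -/
noncomputable def powDir (K : ℕ) (t : ℕ+ →₀ ℂ) : Option (Fin K) → ℕ+ →₀ ℂ :=
  fun o => o.elim t fun j => Finsupp.single (j : ℕ).succPNat 1

/-- The coordinates of the curve `x ↦ t + ε (x, x² / 2, …, x ^ K / K, 0, …)`. -/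
noncomputable def powCurve (K : ℕ) (x : ℂ) : Option (Fin K) → ℂ :=
  fun o => o.elim 1 fun j => ε * (x ^ ((j : ℕ) + 1) / (((j : ℕ) : ℂ) + 1))

theorem sum_powCurve_smul (K : ℕ) (t : ℕ+ →₀ ℂ) (x : ℂ) :
    ∑ o, powCurve ε K x o • powDir K t o = t + ε • powVec K x := by
  simp [Fintype.sum_option, powCurve, powDir, powVec, Finset.smul_sum]

theorem FinitelySmooth.contDiff_powVec (hf : FinitelySmooth f) (K : ℕ) (t : ℕ+ →₀ ℂ) :
    ContDiff ℂ ∞ fun x : ℂ => f (⇑(t + ε • powVec K x)) := by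
  simp only [← sum_powCurve_smul]
  refine (hf _ (powDir K t)).comp (contDiff_pi.2 fun o => ?_)
  cases o
  · exact contDiff_const
  · simp only [powCurve, Option.elim]
    fun_prop

theorem FinitelySmooth.deriv_powVec (hf : FinitelySmooth f) (K : ℕ) (t : ℕ+ →₀ ℂ) (x : ℂ) :
    deriv (fun x : ℂ => f (⇑(t + ε • powVec K x))) x =
      ∑ j ∈ Finset.range K, ((j : ℂ) + 1) *
        (x ^ j * KPTau.scaledPartial ε j.succPNat f (⇑(t + ε • powVec K x))) := by
  classical
  simp only [← sum_powCurve_smul]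
  set F : (Option (Fin K) → ℂ) → ℂ := fun s => f (⇑(∑ o, s o • powDir K t o)) with hF
  have hFd : Differentiable ℂ F := (hf _ (powDir K t)).differentiable (by simp)
  have hcurve : HasDerivAt (powCurve ε K)
      (∑ j : Fin K, (ε * x ^ (j : ℕ)) • (Pi.single (some j) 1 : Option (Fin K) → ℂ)) x := by
    refine hasDerivAt_pi.2 fun o => ?_
    cases o with
    | none => simpa [powCurve] using hasDerivAt_const x (1 : ℂ)
    | some j =>
      have h0 : (((j : ℕ) : ℂ) + 1) ≠ 0 := Nat.cast_add_one_ne_zero _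
      have h1 := ((hasDerivAt_pow ((j : ℕ) + 1) x).div_const (((j : ℕ) : ℂ) + 1)).const_mul ε
      have h2 : (∑ j : Fin K, (ε * x ^ (j : ℕ)) • (Pi.single (some j) 1 : Option (Fin K) → ℂ))
          (some j) = ε * x ^ (j : ℕ) := by
        rw [Finset.sum_apply, Finset.sum_eq_single j]
        · simp
        · intro b _ hb
          simp [hb.symm]
        · simp
      have h3 : ε * ((((j : ℕ) + 1 : ℕ) : ℂ) * x ^ ((j : ℕ) + 1 - 1) / (((j : ℕ) : ℂ) + 1)) =
          ε * x ^ (j : ℕ) := by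
        rw [Nat.add_sub_cancel]
        push_cast
        field_simp
      rw [h2, ← h3]
      exact h1
  have h := (hFd (powCurve ε K x)).hasFDerivAt.comp_hasDerivAt x hcurve
  have h' : deriv (fun x => f (⇑(∑ o, powCurve ε K x o • powDir K t o))) x = _ := h.deriv
  rw [h', map_sum, ← Fin.sum_univ_eq_sum_range (fun j => ((j : ℂ) + 1) *
    (x ^ j * KPTau.scaledPartial ε j.succPNat f (⇑(∑ o, powCurve ε K x o • powDir K t o))))]
  refine Finset.sum_congr rfl fun j _ => ?_
  have h0 : (((j : ℕ) : ℂ) + 1) ≠ 0 := Nat.cast_add_one_ne_zero _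
  rw [map_smul, hF, ← hf.lineDeriv_eq (powDir K t) (powCurve ε K x) (some j),
    KPTau.scaledPartial]
  have h3 : (⇑(powDir K t (some j)) : ℕ+ → ℂ) = Pi.single (j : ℕ).succPNat 1 := by
    simp [powDir, Finsupp.single_eq_pi_single]
  rw [h3, smul_eq_mul, Nat.succPNat_coe]
  push_cast
  field_simp

/-- `∑ h_k(ε ∂_t) x ^ k` is the shift of `t` by `ε (x, x² / 2, x³ / 3, …)`. -/
theorem diffOp_completeSymm_eq_taylorCoeff (k : ℕ) :
    ∀ {f : (ℕ+ → ℂ) → ℂ}, FinitelySmooth f → ∀ (t : ℕ+ →₀ ℂ) {K : ℕ}, k ≤ K →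
      diffOp ε (completeSymm k) f t =
        taylorCoeff (fun x => f (⇑(t + ε • powVec K x))) k := by
  induction k using Nat.strong_induction_on with
  | _ k ih =>
    intro f hf t K hK
    cases k with
    | zero =>
      rw [completeSymm_zero, diffOp_one, taylorCoeff_zero]
      simp [powVec]
    | succ k =>
      have h0 : ((k : ℂ) + 1) ≠ 0 := Nat.cast_add_one_ne_zero k
      rw [← mul_right_inj' h0, hf.diffOp_completeSymm_succ]
      have h1 : ((k : ℂ) + 1) * taylorCoeff (fun x => f (⇑(t + ε • powVec K x))) (k + 1) =
          taylorCoeff (deriv fun x => f (⇑(t + ε • powVec K x))) k := by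
        have h2 : (k.factorial : ℂ) ≠ 0 := by exact_mod_cast k.factorial_ne_zero
        rw [taylorCoeff, taylorCoeff, iteratedDeriv_succ', Nat.factorial_succ]
        push_cast
        field_simp
      have hsm : ∀ j : ℕ, ContDiff ℂ ∞ fun x : ℂ =>
          KPTau.scaledPartial ε j.succPNat f (⇑(t + ε • powVec K x)) := fun j =>
        (hf.scaledPartial ε _).contDiff_powVec ε K t
      have hsm' : ∀ j n : ℕ, ContDiffAt ℂ n (fun x : ℂ =>
          KPTau.scaledPartial ε j.succPNat f (⇑(t + ε • powVec K x))) 0 := fun j n =>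
        ((hsm j).of_le (by exact_mod_cast le_top)).contDiffAt
      have hpow : ∀ j n : ℕ, ContDiffAt ℂ n (fun x : ℂ => x ^ j) 0 := fun j n => by fun_prop
      rw [h1, funext (hf.deriv_powVec ε K t), taylorCoeff_sum fun j _ =>
        contDiffAt_const.mul ((hpow j k).mul (hsm' j k))]
      rw [← Finset.sum_subset (Finset.range_subset_range.2 hK)]
      · refine Finset.sum_congr rfl fun j hj => ?_
        have hj' : j ≤ k := Nat.lt_succ_iff.1 (Finset.mem_range.1 hj)
        rw [taylorCoeff_const_mul, taylorCoeff_mul (hpow j k) (hsm' j k),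
          Finset.sum_eq_single j]
        · rw [ih (k - j) (by omega) (hf.scaledPartial ε _) t (by omega : k - j ≤ K)]
          have := taylorCoeff_pow j j
          rw [if_pos rfl] at this
          simp only [this, one_mul]
        · intro b _ hb
          have := taylorCoeff_pow j b
          rw [if_neg hb] at this
          simp only [this, zero_mul]
        · intro h
          exact absurd (Finset.mem_range.2 (by omega)) h
      · intro j _ hj
        have hj' : k < j := by
          have := Finset.mem_range.not.1 hj
          omega
        rw [taylorCoeff_const_mul, taylorCoeff_mul (hpow j k) (hsm' j k),
          Finset.sum_eq_zero, mul_zero]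
        intro b hb
        have hb' := Finset.mem_range.1 hb
        have := taylorCoeff_pow j b
        rw [if_neg (by omega)] at this
        simp only [this, zero_mul]

end

/-! ### The two-point flow -/

/-- The flow parameters `t_i = (x ^ i - y ^ i) / i`, for which `γ(t) = (1 - y z) / (1 - x z)`. -/
noncomputable def twoPointFlow (x y : ℂ) : ℕ+ → ℂ := fun i => (x ^ (i : ℕ) - y ^ (i : ℕ)) / (i : ℕ)

theorem neg_twoPointFlow (x y : ℂ) : -twoPointFlow x y = twoPointFlow y x := by
  ext i
  simp only [twoPointFlow, Pi.neg_apply]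
  ring

/-- The radius `2` exceeds `1`, as the estimates for the tau function require, and `1 / 64` is small
enough for the weighted norm of a difference to stay below the threshold `1 / 8` of
`IsAdmissibleFrame.exists_norm_tau_sub_le`. -/
theorem flowNormLE_of_norm_le {t : ℕ+ → ℂ} {c : ℝ}
    (h : ∀ i : ℕ+, ‖t i‖ ≤ 2 * c * (1 / 64) ^ (i : ℕ)) :
    FlowNormLE t 2 (c / 8) := by
  have hc : 0 ≤ c := by
    have := (norm_nonneg _).trans (h 1)
    norm_num at this
    exact this
  have hle : ∀ i : ℕ+, ‖t i‖ * 2 ^ (i : ℕ) ≤ 2 * c * (1 / 32) ^ (i : ℕ) := fun i => by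
    refine (mul_le_mul_of_nonneg_right (h i) (by positivity)).trans (le_of_eq ?_)
    rw [mul_assoc, ← mul_pow]
    norm_num
  have hs : HasSum (fun i : ℕ+ => 2 * c * (1 / 32 : ℝ) ^ (i : ℕ)) (2 * c * (1 / 31)) := by
    refine HasSum.mul_left _ ?_
    have h1 := (hasSum_geometric_of_lt_one (r := (1 / 32 : ℝ)) (by norm_num)
      (by norm_num)).mul_left (1 / 32)
    rw [← Equiv.pnatEquivNat.symm.hasSum_iff]
    convert h1 using 1
    · ext n
      simp [pow_succ, mul_comm]
    · norm_num
  refine ⟨Summable.of_nonneg_of_le (fun i => by positivity) hle hs.summable, ?_⟩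
  refine (hasSum_le hle (Summable.of_nonneg_of_le (fun i => by positivity) hle
    hs.summable).hasSum hs).trans ?_
  linarith

theorem norm_twoPointFlow_le {x y : ℂ} {ρ : ℝ} (hx : ‖x‖ ≤ ρ) (hy : ‖y‖ ≤ ρ) (i : ℕ+) :
    ‖twoPointFlow x y i‖ ≤ 2 * ρ ^ (i : ℕ) := by
  have hi : (1 : ℝ) ≤ ((i : ℕ) : ℝ) := by exact_mod_cast i.pos
  rw [twoPointFlow, norm_div, Complex.norm_natCast]
  refine (div_le_self (norm_nonneg _) hi).trans ((norm_sub_le _ _).trans ?_)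
  rw [norm_pow, norm_pow, two_mul]
  gcongr

theorem hasSum_pnat_pow_div {w : ℂ} (hw : ‖w‖ < 1) :
    HasSum (fun i : ℕ+ => w ^ (i : ℕ) / ((i : ℕ) : ℂ)) (-Complex.log (1 - w)) := by
  refine (PNat.coe_injective.hasSum_iff (f := fun n : ℕ => w ^ n / (n : ℂ)) fun n hn => ?_).2
    (Complex.hasSum_taylorSeries_neg_log hw)
  have : n = 0 := by
    by_contra h
    exact hn ⟨⟨n, Nat.pos_of_ne_zero h⟩, rfl⟩
  simp [this]

theorem genFun_twoPointFlow {x y z : ℂ} (hx : ‖x * z‖ < 1) (hy : ‖y * z‖ < 1) :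
    (1 - x * z) * genFun (twoPointFlow x y) z = 1 - y * z := by
  have h1 : ∀ w : ℂ, ‖w‖ < 1 → 1 - w ≠ 0 := fun w hw h => by
    rw [← sub_eq_zero.1 h] at hw
    simp at hw
  have h := (hasSum_pnat_pow_div hx).sub (hasSum_pnat_pow_div hy)
  have h2 : ∑' i : ℕ+, twoPointFlow x y i * z ^ (i : ℕ) =
      -Complex.log (1 - x * z) - -Complex.log (1 - y * z) := by
    rw [← h.tsum_eq]
    refine tsum_congr fun i => ?_
    rw [twoPointFlow, mul_pow, mul_pow]
    ring
  rw [genFun, h2, sub_neg_eq_add, Complex.exp_add, Complex.exp_neg, Complex.exp_log (h1 _ hx),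
    Complex.exp_log (h1 _ hy), ← mul_assoc, mul_inv_cancel₀ (h1 _ hx), one_mul]

section

variable {x y : ℂ}

theorem flowNormLE_twoPointFlow (hx : ‖x‖ ≤ 1 / 64) (hy : ‖y‖ ≤ 1 / 64) :
    FlowNormLE (twoPointFlow x y) 2 (1 / 8) :=
  flowNormLE_of_norm_le fun i => by simpa using norm_twoPointFlow_le hx hy i

theorem flowCoeff_twoPointFlow_succ (hx : ‖x‖ ≤ 1 / 64) (hy : ‖y‖ ≤ 1 / 64) (n : ℕ) :
    flowCoeff (twoPointFlow x y) (n + 1) = (x - y) * x ^ n := by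
  have hev : (fun z => (1 - x * z) * genFun (twoPointFlow x y) z) =ᶠ[𝓝 0]
      fun z => (1 - y * z) * z ^ 0 := by
    filter_upwards [Metric.ball_mem_nhds (0 : ℂ) one_pos] with z hz
    have hz' : ‖z‖ < 1 := mem_ball_zero_iff.1 hz
    rw [pow_zero, mul_one]
    refine genFun_twoPointFlow ?_ ?_ <;> rw [norm_mul] <;> nlinarith [norm_nonneg z]
  have key : ∀ n : ℕ, flowCoeff (twoPointFlow x y) (n + 1) =
      x * flowCoeff (twoPointFlow x y) n - if n = 0 then y else 0 := fun n => by
    have h1 := taylorCoeff_mul_linear (n := n) 1 x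
      ((flowNormLE_twoPointFlow hx hy).contDiffAt two_pos (n + 1))
    have h2 := taylorCoeff_mul_linear (n := n) 1 y
      (by fun_prop : ContDiffAt ℂ (n + 1 : ℕ) (fun z : ℂ => z ^ 0) 0)
    rw [taylorCoeff, hev.iteratedDeriv_eq] at h1
    rw [taylorCoeff, h1, taylorCoeff_pow, taylorCoeff_pow] at h2
    simp only [Nat.succ_ne_zero, if_false, mul_zero, zero_sub, mul_ite, mul_one] at h2
    rw [flowCoeff, flowCoeff]
    linear_combination h2
  induction n with
  | zero => rw [key, flowCoeff_zero_right]; simp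
  | succ n ih =>
    rw [key, ih, if_neg (Nat.succ_ne_zero n)]
    ring

/-- The Hankel-type matrix of the two-point flow has rank one. -/
theorem hankelMatrix_twoPointFlow (hx : ‖x‖ ≤ 1 / 64) (hy : ‖y‖ ≤ 1 / 64) (i l : ℕ) :
    hankelMatrix (flowCoeff (-twoPointFlow x y)) (flowCoeff (twoPointFlow x y)) i l =
      (x - y) * y ^ i * x ^ l := by
  rw [hankelMatrix, Matrix.of_apply, neg_twoPointFlow, Finset.sum_range_succ',
    flowCoeff_zero_right, flowCoeff_twoPointFlow_succ hx hy]
  have h : ∀ k ∈ Finset.range i, flowCoeff (twoPointFlow y x) (k + 1) *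
      flowCoeff (twoPointFlow x y) (i - (k + 1) + l + 1) =
        (y ^ k * x ^ (i - 1 - k)) * ((y - x) * (x - y) * x ^ l) := fun k _ => by
    rw [flowCoeff_twoPointFlow_succ hx hy, flowCoeff_twoPointFlow_succ hy hx, pow_add,
      Nat.sub_sub, add_comm k 1]
    ring
  rw [Finset.sum_congr rfl h, ← Finset.sum_mul]
  have := geom_sum₂_mul y x i
  rw [Nat.sub_zero, pow_add]
  linear_combination (x - y) * x ^ l * this

/-- The tau function at the two-point flow is a generating function of the affine coordinates. -/
theorem IsAdmissibleFrame.tau_twoPointFlow {W : Hplus →L[ℂ] L2Circle} {w : Submodule ℂ L2Circle}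
    (hW : IsAdmissibleFrame W w) (hw : InBigCell w) (hx : ‖x‖ ≤ 1 / 64) (hy : ‖y‖ ≤ 1 / 64) :
    tau W (twoPointFlow x y) =
      tau W 0 * (1 + (x - y) * ∑' b, y ^ b * ∑' a, x ^ a * affineCoord W a b) := by
  have h : flowPerturbation W (twoPointFlow x y) = Matrix.of fun i j => (x - y) * y ^ i *
      ∑' l : ℕ, x ^ l * fourierCoeff (W (monomial j)) (-(l : ℤ) - 1) := by
    ext i j
    rw [flowPerturbation, Matrix.of_apply, Matrix.of_apply, ← tsum_mul_left]
    refine tsum_congr fun l => ?_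
    rw [hankelMatrix_twoPointFlow hx hy]
    ring
  rw [(flowNormLE_twoPointFlow hx hy).tau_eq one_lt_two, h, tau_zero,
    hW.infDet_rankOne_perturbation hw (by linarith) (by linarith)]

theorem powVec_apply (K : ℕ) (x : ℂ) (i : ℕ+) :
    powVec K x i = if (i : ℕ) ≤ K then x ^ (i : ℕ) / ((i : ℕ) : ℂ) else 0 := by
  obtain ⟨n, rfl⟩ : ∃ n : ℕ, i = n.succPNat := ⟨i.natPred, (PNat.succPNat_natPred i).symm⟩
  simp only [powVec, Finsupp.coe_finsetSum, Finset.sum_apply, Finsupp.smul_apply, smul_eq_mul,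
    Finsupp.single_apply, Nat.succPNat_inj, Nat.succPNat_coe, mul_ite, mul_one, mul_zero]
  rw [Fin.sum_univ_eq_sum_range (fun j => if j = n then x ^ (j + 1) / ((j : ℂ) + 1) else 0),
    Finset.sum_ite_eq']
  simp

theorem powVec_sub_apply (K : ℕ) (x y : ℂ) (i : ℕ+) :
    (powVec K x - powVec K y) i = if (i : ℕ) ≤ K then twoPointFlow x y i else 0 := by
  rw [Finsupp.sub_apply, powVec_apply, powVec_apply, twoPointFlow]
  split_ifs <;> ring

/-- Truncating the two-point flow after `K` variables changes the tau function by a quantity that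
vanishes to order `K + 1` at the origin. -/
theorem IsAdmissibleFrame.exists_norm_tau_powVec_sub_le {W : Hplus →L[ℂ] L2Circle}
    {w : Submodule ℂ L2Circle} (hW : IsAdmissibleFrame W w) (hw : InGrassmannian w) (K : ℕ) :
    ∃ C, ∀ σ : ℝ, 0 < σ → σ ≤ 1 → ∀ x y : ℂ, ‖x‖ ≤ σ / 64 → ‖y‖ ≤ σ / 64 →
      ‖tau W (⇑(powVec K x - powVec K y)) - tau W (twoPointFlow x y)‖ ≤ C * σ ^ (K + 1) := by
  obtain ⟨C, -, hC⟩ := hW.exists_norm_tau_sub_le hw one_lt_two (1 / 8)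
  refine ⟨C * (1 / 8), fun σ hσ hσ1 x y hx hy => ?_⟩
  have hσK : σ ^ (K + 1) ≤ 1 := pow_le_one₀ hσ.le hσ1
  have hb := norm_twoPointFlow_le hx hy
  have hb1 : ∀ i : ℕ+, ‖twoPointFlow x y i‖ ≤ 2 * 1 * (1 / 64) ^ (i : ℕ) := fun i =>
    (hb i).trans (by rw [mul_one]; gcongr)
  have h1 : FlowNormLE (⇑(powVec K x - powVec K y)) 2 (1 / 8) := flowNormLE_of_norm_le fun i => by
    rw [powVec_sub_apply]
    split_ifs
    · exact hb1 i
    · rw [norm_zero]; positivity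
  have h2 : FlowNormLE (⇑(powVec K x - powVec K y) - twoPointFlow x y) 2 (σ ^ (K + 1) / 8) :=
    flowNormLE_of_norm_le fun i => by
      rw [Pi.sub_apply, powVec_sub_apply]
      split_ifs with h
      · rw [sub_self, norm_zero]; positivity
      · rw [zero_sub, norm_neg]
        refine (hb i).trans ?_
        rw [div_pow, one_div_pow, div_eq_mul_one_div, ← mul_assoc]
        gcongr 2 * ?_ * _
        exact pow_le_pow_of_le_one hσ.le hσ1 (by omega)
  have := hC _ _ _ (flowNormLE_of_norm_le hb1) h1 h2 (by positivity) (by linarith)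
  linarith

end

/-! ### Double power series -/

/-- The double power series `∑ c_{pq} x ^ p y ^ q`. -/
noncomputable def doubleSeries (c : ℕ → ℕ → ℂ) (x y : ℂ) : ℂ := ∑' q, y ^ q * ∑' p, x ^ p * c p q

section

variable {x y : ℂ} {ρ C D : ℝ}

theorem norm_pow_mul_le (hρ : ‖x‖ ≤ ρ) {c : ℕ → ℂ} (hc : ∀ p, ‖c p‖ ≤ C) (p : ℕ) :
    ‖x ^ p * c p‖ ≤ C * ρ ^ p := by
  rw [norm_mul, norm_pow, mul_comm]
  have := (norm_nonneg _).trans (hc p)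
  gcongr
  exact hc p

theorem summable_pow_mul (hx : ‖x‖ ≤ 1 / 2) {c : ℕ → ℂ} (hc : ∀ p, ‖c p‖ ≤ C) :
    Summable fun p => x ^ p * c p :=
  Summable.of_norm_bounded ((summable_geometric_of_lt_one (by norm_num)
    (by norm_num : (1 / 2 : ℝ) < 1)).mul_left C) (norm_pow_mul_le hx hc)

/-- The tail of a power series with bounded coefficients. -/
theorem norm_tsum_sub_sum_le (hx : ‖x‖ ≤ ρ) (hρ : ρ ≤ 1 / 2) {c : ℕ → ℂ} (hc : ∀ p, ‖c p‖ ≤ C)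
    (N : ℕ) : ‖∑' p, x ^ p * c p - ∑ p ∈ Finset.range N, x ^ p * c p‖ ≤ 2 * C * ρ ^ N := by
  have hC : 0 ≤ C := (norm_nonneg _).trans (hc 0)
  have hρ0 : 0 ≤ ρ := (norm_nonneg _).trans hx
  rw [← (summable_pow_mul (hx.trans hρ) hc).sum_add_tsum_nat_add N, add_sub_cancel_left]
  have hg := (hasSum_geometric_of_lt_one hρ0 (by linarith)).mul_left (C * ρ ^ N)
  refine (tsum_of_norm_bounded hg fun p => ?_).trans ?_
  · refine (norm_pow_mul_le hx hc (p + N)).trans (le_of_eq ?_)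
    ring
  · have : (1 - ρ)⁻¹ ≤ 2 := by
      rw [inv_le_comm₀ (by linarith) two_pos]
      linarith
    calc C * ρ ^ N * (1 - ρ)⁻¹ ≤ C * ρ ^ N * 2 := by gcongr
      _ = _ := by ring

theorem norm_tsum_pow_mul_le (hx : ‖x‖ ≤ 1 / 2) {c : ℕ → ℂ} (hc : ∀ p, ‖c p‖ ≤ C) :
    ‖∑' p, x ^ p * c p‖ ≤ 2 * C := by
  simpa using norm_tsum_sub_sum_le hx le_rfl hc 0

theorem norm_doubleSeries_sub_sum_le (hx : ‖x‖ ≤ ρ) (hy : ‖y‖ ≤ ρ) (hρ : ρ ≤ 1 / 2)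
    {c : ℕ → ℕ → ℂ} (hc : ∀ p q, ‖c p q‖ ≤ C) (N : ℕ) :
    ‖doubleSeries c x y - ∑ q ∈ Finset.range N, ∑ p ∈ Finset.range N, c p q * x ^ p * y ^ q‖ ≤
      12 * C * ρ ^ N := by
  have hC : 0 ≤ C := (norm_nonneg _).trans (hc 0 0)
  have hρ0 : 0 ≤ ρ := (norm_nonneg _).trans hx
  have hpow : ρ ^ N ≤ 1 := pow_le_one₀ hρ0 (by linarith)
  have h1 : ∀ q, ‖∑' p, x ^ p * c p q - ∑ p ∈ Finset.range N, x ^ p * c p q‖ ≤ 2 * C * ρ ^ N :=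
    fun q => norm_tsum_sub_sum_le hx hρ (fun p => hc p q) N
  have h2 : ∀ q, ‖∑' p, x ^ p * c p q‖ ≤ 2 * C := fun q =>
    norm_tsum_pow_mul_le (hx.trans hρ) fun p => hc p q
  have h3 : ∀ q, ‖∑ p ∈ Finset.range N, x ^ p * c p q‖ ≤ 4 * C := fun q => by
    have := norm_sub_le (∑' p, x ^ p * c p q)
      (∑' p, x ^ p * c p q - ∑ p ∈ Finset.range N, x ^ p * c p q)
    rw [sub_sub_cancel] at this
    nlinarith [h1 q, h2 q]
  have h4 := norm_tsum_sub_sum_le hy hρ h3 N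
  have h5 := norm_tsum_pow_mul_le (hy.trans hρ) h1
  simp only [mul_sub] at h5
  rw [(summable_pow_mul (hy.trans hρ) h2).tsum_sub (summable_pow_mul (hy.trans hρ) h3)] at h5
  have h6 : ∑ q ∈ Finset.range N, ∑ p ∈ Finset.range N, c p q * x ^ p * y ^ q =
      ∑ q ∈ Finset.range N, y ^ q * ∑ p ∈ Finset.range N, x ^ p * c p q := by
    refine Finset.sum_congr rfl fun q _ => ?_
    rw [Finset.mul_sum]
    exact Finset.sum_congr rfl fun p _ => by ring
  rw [h6, doubleSeries]
  refine (norm_sub_le_norm_sub_add_norm_sub _ (∑' q, y ^ q * ∑ p ∈ Finset.range N, x ^ p * c p q)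
    _).trans ?_
  linarith

theorem doubleSeries_add (hx : ‖x‖ ≤ 1 / 2) (hy : ‖y‖ ≤ 1 / 2) {c d : ℕ → ℕ → ℂ}
    (hc : ∀ p q, ‖c p q‖ ≤ C) (hd : ∀ p q, ‖d p q‖ ≤ D) :
    doubleSeries (fun p q => c p q + d p q) x y = doubleSeries c x y + doubleSeries d x y := by
  have h : ∀ q, ∑' p, x ^ p * (c p q + d p q) =
      ∑' p, x ^ p * c p q + ∑' p, x ^ p * d p q := fun q => by
    simp only [mul_add]
    exact (summable_pow_mul hx fun p => hc p q).tsum_add (summable_pow_mul hx fun p => hd p q)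
  simp only [doubleSeries, h]
  simp only [mul_add]
  exact (summable_pow_mul hy fun q => norm_tsum_pow_mul_le hx fun p => hc p q).tsum_add
    (summable_pow_mul hy fun q => norm_tsum_pow_mul_le hx fun p => hd p q)

theorem doubleSeries_neg (c : ℕ → ℕ → ℂ) (x y : ℂ) :
    doubleSeries (fun p q => -c p q) x y = -doubleSeries c x y := by
  simp [doubleSeries, tsum_neg]

theorem tsum_pow_mul_shift (hx : ‖x‖ ≤ 1 / 2) {c : ℕ → ℂ} (hc : ∀ p, ‖c p‖ ≤ C) :
    ∑' p, x ^ p * (if p = 0 then 0 else c (p - 1)) = x * ∑' p, x ^ p * c p := by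
  have h : ∀ p, ‖(if p = 0 then 0 else c (p - 1) : ℂ)‖ ≤ C := fun p => by
    split_ifs
    · rw [norm_zero]; exact (norm_nonneg _).trans (hc 0)
    · exact hc _
  rw [(summable_pow_mul hx h).tsum_eq_zero_add, ← tsum_mul_left]
  simp [pow_succ', mul_assoc]

theorem doubleSeries_single (x y : ℂ) :
    doubleSeries (fun p q => if p = 0 ∧ q = 0 then 1 else 0) x y = 1 := by
  rw [doubleSeries, tsum_eq_single 0, tsum_eq_single 0]
  · simp
  · intro p hp; simp [hp]
  · intro q hq; simp [hq]

/-- The coefficients of `1 + (x - y) ∑ A_{ab} x ^ a y ^ b`. -/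
noncomputable def bilinearCoeff (A : ℕ → ℕ → ℂ) (p q : ℕ) : ℂ :=
  (if p = 0 ∧ q = 0 then 1 else 0) +
    ((if p = 0 then 0 else A (p - 1) q) + -(if q = 0 then 0 else A p (q - 1)))

theorem norm_bilinearCoeff_le {A : ℕ → ℕ → ℂ} (hA : ∀ a b, ‖A a b‖ ≤ C) (p q : ℕ) :
    ‖bilinearCoeff A p q‖ ≤ 1 + (C + C) := by
  have hC : 0 ≤ C := (norm_nonneg _).trans (hA 0 0)
  rw [bilinearCoeff]
  refine (norm_add_le _ _).trans (add_le_add ?_ ((norm_add_le _ _).trans (add_le_add ?_ ?_)))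
  · split_ifs <;> simp
  · split_ifs
    · simpa using hC
    · exact hA _ _
  · rw [norm_neg]
    split_ifs
    · simpa using hC
    · exact hA _ _

theorem doubleSeries_bilinearCoeff (hx : ‖x‖ ≤ 1 / 2) (hy : ‖y‖ ≤ 1 / 2) {A : ℕ → ℕ → ℂ}
    (hA : ∀ a b, ‖A a b‖ ≤ C) :
    doubleSeries (bilinearCoeff A) x y = 1 + (x - y) * doubleSeries A x y := by
  have hC : 0 ≤ C := (norm_nonneg _).trans (hA 0 0)
  have h0 : ∀ p q : ℕ, ‖(if p = 0 ∧ q = 0 then 1 else 0 : ℂ)‖ ≤ 1 := fun p q => by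
    split_ifs <;> simp
  have h1 : ∀ p q : ℕ, ‖(if p = 0 then 0 else A (p - 1) q)‖ ≤ C := fun p q => by
    split_ifs
    · simpa using hC
    · exact hA _ _
  have h2 : ∀ p q : ℕ, ‖-(if q = 0 then 0 else A p (q - 1))‖ ≤ C := fun p q => by
    rw [norm_neg]
    split_ifs
    · simpa using hC
    · exact hA _ _
  have h12 : ∀ p q : ℕ, ‖(if p = 0 then 0 else A (p - 1) q) +
      -(if q = 0 then 0 else A p (q - 1))‖ ≤ C + C := fun p q =>
    (norm_add_le _ _).trans (add_le_add (h1 p q) (h2 p q))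
  have e1 : doubleSeries (fun p q => if p = 0 then 0 else A (p - 1) q) x y =
      x * doubleSeries A x y := by
    rw [doubleSeries, doubleSeries, ← tsum_mul_left]
    refine tsum_congr fun q => ?_
    rw [tsum_pow_mul_shift hx (c := fun p => A p q) fun p => hA p q]
    ring
  have e2 : doubleSeries (fun p q => if q = 0 then 0 else A p (q - 1)) x y =
      y * doubleSeries A x y := by
    rw [doubleSeries, doubleSeries, ← tsum_pow_mul_shift hy
      (fun q => norm_tsum_pow_mul_le hx fun p => hA p q)]
    refine tsum_congr fun q => ?_
    split_ifs <;> simp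
  unfold bilinearCoeff
  rw [doubleSeries_add hx hy h0 h12, doubleSeries_add hx hy h1 h2, doubleSeries_neg,
    doubleSeries_single, e1, e2]
  ring

end

/-! ### Reading off mixed Taylor coefficients -/

/-- Cauchy's estimates in two variables. -/
theorem taylorCoeff_taylorCoeff_eq_zero {φ : ℂ → ℂ → ℂ} {C : ℝ} {K m n : ℕ} (hmn : m + n ≤ K)
    (hy : ∀ x, Differentiable ℂ (φ x)) (hx : Differentiable ℂ fun x => taylorCoeff (φ x) n)
    (hb : ∀ σ : ℝ, 0 < σ → σ ≤ 1 → ∀ x y : ℂ, ‖x‖ ≤ σ / 64 → ‖y‖ ≤ σ / 64 →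
      ‖φ x y‖ ≤ C * σ ^ (K + 1)) :
    taylorCoeff (fun x => taylorCoeff (φ x) n) m = 0 := by
  have hC : 0 ≤ C := by
    have := (norm_nonneg _).trans (hb 1 one_pos le_rfl 0 0 (by norm_num) (by norm_num))
    simpa using this
  have key : ∀ σ : ℝ, 0 < σ → σ ≤ 1 →
      ‖taylorCoeff (fun x => taylorCoeff (φ x) n) m‖ ≤ C * 64 ^ (m + n) * σ := by
    intro σ hσ hσ1
    have hσ' : 0 < σ / 64 := by positivity
    have h1 : ∀ x ∈ Metric.sphere (0 : ℂ) (σ / 64),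
        ‖taylorCoeff (φ x) n‖ ≤ C * σ ^ (K + 1) / (σ / 64) ^ n := fun x hx' =>
      norm_taylorCoeff_le n hσ' (hy x).diffContOnCl fun y hy' =>
        hb σ hσ hσ1 x y (mem_sphere_zero_iff_norm.1 hx').le (mem_sphere_zero_iff_norm.1 hy').le
    refine (norm_taylorCoeff_le m hσ' hx.diffContOnCl h1).trans ?_
    obtain ⟨d, rfl⟩ := Nat.exists_eq_add_of_le hmn
    have e : C * σ ^ (m + n + d + 1) / (σ / 64) ^ n / (σ / 64) ^ m =
        C * 64 ^ (m + n) * (σ * σ ^ d) := by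
      rw [div_pow, div_pow]
      field_simp
      ring
    rw [e]
    gcongr
    exact mul_le_of_le_one_right hσ.le (pow_le_one₀ hσ.le hσ1)
  rw [← norm_eq_zero]
  refine le_antisymm (le_of_forall_pos_le_add fun δ hδ => ?_) (norm_nonneg _)
  set D := C * 64 ^ (m + n) + 1 with hD
  have hD0 : 0 < D := by positivity
  refine (key (min 1 (δ / D)) (by positivity) (min_le_left _ _)).trans ?_
  rw [zero_add]
  calc C * 64 ^ (m + n) * min 1 (δ / D) ≤ D * (δ / D) := by
        gcongr
        · linarith
        · exact min_le_right _ _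
    _ = δ := by field_simp

theorem taylorCoeff_sum_mul_pow {N n : ℕ} (hn : n < N) (c : ℕ → ℂ) :
    taylorCoeff (fun z => ∑ k ∈ Finset.range N, c k * z ^ k) n = c n := by
  rw [taylorCoeff_sum fun k _ => by fun_prop, Finset.sum_eq_single n]
  · rw [taylorCoeff_const_mul, taylorCoeff_pow, if_pos rfl, mul_one]
  · intro k _ hk
    rw [taylorCoeff_const_mul, taylorCoeff_pow, if_neg hk.symm, mul_zero]
  · intro h
    exact absurd (Finset.mem_range.2 hn) h

/-- The iterated operator `h_m(ε ∂_t) h_n(ε' ∂_t)` extracts the coefficient of `x ^ m y ^ n` from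
`f` at the superposition of `ε (x, x² / 2, …)` and `ε' (y, y² / 2, …)`. -/
theorem FinitelySmooth.diffOp_diffOp_completeSymm_eq {f : (ℕ+ → ℂ) → ℂ} (hf : FinitelySmooth f)
    (ε ε' : ℂ) {K m n : ℕ} (hmn : m + n ≤ K) {c : ℕ → ℕ → ℂ} {C : ℝ}
    (hb : ∀ σ : ℝ, 0 < σ → σ ≤ 1 → ∀ x y : ℂ, ‖x‖ ≤ σ / 64 → ‖y‖ ≤ σ / 64 →
      ‖f (⇑(ε • powVec K x + ε' • powVec K y)) - ∑ q ∈ Finset.range (K + 1),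
        ∑ p ∈ Finset.range (K + 1), c p q * x ^ p * y ^ q‖ ≤ C * σ ^ (K + 1)) :
    KPTau.diffOp ε (completeSymm m) (KPTau.diffOp ε' (completeSymm n) f) 0 = c m n := by
  have hinner : ∀ x, taylorCoeff (fun y => f (⇑(ε • powVec K x + ε' • powVec K y))) n =
      KPTau.diffOp ε' (completeSymm n) f (⇑(0 + ε • powVec K x)) := fun x => by
    rw [zero_add, diffOp_completeSymm_eq_taylorCoeff ε' n hf _ (by omega : n ≤ K)]
  have hpoly : ∀ x, taylorCoeff (fun y => ∑ q ∈ Finset.range (K + 1),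
      ∑ p ∈ Finset.range (K + 1), c p q * x ^ p * y ^ q) n =
        ∑ p ∈ Finset.range (K + 1), c p n * x ^ p := fun x => by
    simp only [← Finset.sum_mul]
    exact taylorCoeff_sum_mul_pow (by omega) _
  have houter : ContDiff ℂ ∞ fun x =>
      KPTau.diffOp ε' (completeSymm n) f (⇑(0 + ε • powVec K x)) :=
    (hf.diffOp ε' _).contDiff_powVec ε K 0
  have hsub : ∀ x, taylorCoeff (fun y => f (⇑(ε • powVec K x + ε' • powVec K y)) -
      ∑ q ∈ Finset.range (K + 1), ∑ p ∈ Finset.range (K + 1), c p q * x ^ p * y ^ q) n =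
        KPTau.diffOp ε' (completeSymm n) f (⇑(0 + ε • powVec K x)) -
          ∑ p ∈ Finset.range (K + 1), c p n * x ^ p := fun x => by
    rw [taylorCoeff_sub (contDiff_infty.1 (hf.contDiff_powVec ε' K _) n).contDiffAt
      (by fun_prop), hinner, hpoly]
  have h := taylorCoeff_taylorCoeff_eq_zero hmn
    (fun x => ((hf.contDiff_powVec ε' K (ε • powVec K x)).differentiable (by simp)).sub
      (by fun_prop)) (by
        simp only [Pi.sub_def, hsub]
        exact (houter.differentiable (by simp)).sub (by fun_prop)) hb
  simp only [Pi.sub_def, hsub] at h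
  rw [taylorCoeff_sub (contDiff_infty.1 houter m).contDiffAt (by fun_prop),
    taylorCoeff_sum_mul_pow (by omega) fun p => c p n,
    ← diffOp_completeSymm_eq_taylorCoeff ε m (hf.diffOp ε' _) 0 (by omega : m ≤ K),
    Finsupp.coe_zero, sub_eq_zero] at h
  exact h

/-! ### The affine coordinates -/

section

variable {W : Hplus →L[ℂ] L2Circle} {w : Submodule ℂ L2Circle}

theorem IsAdmissibleFrame.finitelySmooth_tau (hW : IsAdmissibleFrame W w) (hw : InGrassmannian w) :
    FinitelySmooth (tau W) := fun _ _ v => hW.contDiff_tau hw v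

/-- The Taylor polynomial of the tau function at the truncated two-point flow, with remainder. -/
theorem IsAdmissibleFrame.exists_norm_tau_powVec_sub_sum_le (hW : IsAdmissibleFrame W w)
    (hw : InBigCell w) (K : ℕ) :
    ∃ C, ∀ σ : ℝ, 0 < σ → σ ≤ 1 → ∀ x y : ℂ, ‖x‖ ≤ σ / 64 → ‖y‖ ≤ σ / 64 →
      ‖tau W (⇑(powVec K x - powVec K y)) - ∑ q ∈ Finset.range (K + 1),
        ∑ p ∈ Finset.range (K + 1), tau W 0 * bilinearCoeff (affineCoord W) p q * x ^ p * y ^ q‖ ≤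
          C * σ ^ (K + 1) := by
  obtain ⟨C, hC⟩ := hW.exists_norm_tau_powVec_sub_le hw.toInGrassmannian K
  obtain ⟨A, hA⟩ := exists_norm_affineCoord_le W
  refine ⟨C + ‖tau W 0‖ * (12 * (1 + (A + A))), fun σ hσ hσ1 x y hx hy => ?_⟩
  have hA0 : 0 ≤ A := (norm_nonneg _).trans (hA 0 0)
  have h1 := hC σ hσ hσ1 x y hx hy
  have h2 := norm_doubleSeries_sub_sum_le hx hy (by linarith) (norm_bilinearCoeff_le hA)
    (K + 1)
  have h3 : tau W (twoPointFlow x y) =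
      tau W 0 * doubleSeries (bilinearCoeff (affineCoord W)) x y := by
    rw [doubleSeries_bilinearCoeff (by linarith) (by linarith) hA,
      hW.tau_twoPointFlow hw (by linarith) (by linarith), doubleSeries]
  have h4 : ∑ q ∈ Finset.range (K + 1), ∑ p ∈ Finset.range (K + 1),
      tau W 0 * bilinearCoeff (affineCoord W) p q * x ^ p * y ^ q =
      tau W 0 * ∑ q ∈ Finset.range (K + 1), ∑ p ∈ Finset.range (K + 1),
        bilinearCoeff (affineCoord W) p q * x ^ p * y ^ q := by
    simp only [Finset.mul_sum, mul_assoc]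
  have h5 : (σ / 64) ^ (K + 1) ≤ σ ^ (K + 1) := by
    gcongr
    linarith
  have h6 : ‖tau W (twoPointFlow x y) - ∑ q ∈ Finset.range (K + 1), ∑ p ∈ Finset.range (K + 1),
      tau W 0 * bilinearCoeff (affineCoord W) p q * x ^ p * y ^ q‖ ≤
      ‖tau W 0‖ * (12 * (1 + (A + A)) * σ ^ (K + 1)) := by
    rw [h3, h4, ← mul_sub, norm_mul]
    gcongr
    exact h2.trans (by gcongr)
  refine (norm_sub_le_norm_sub_add_norm_sub _ (tau W (twoPointFlow x y)) _).trans ?_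
  linarith

theorem IsAdmissibleFrame.diffOp_one_diffOp_neg_one (hW : IsAdmissibleFrame W w)
    (hw : InBigCell w) (m n : ℕ) :
    diffOp 1 (completeSymm m) (diffOp (-1) (completeSymm n) (tau W)) 0 =
      tau W 0 * bilinearCoeff (affineCoord W) m n := by
  obtain ⟨C, hC⟩ := hW.exists_norm_tau_powVec_sub_sum_le hw (m + n)
  refine (hW.finitelySmooth_tau hw.toInGrassmannian).diffOp_diffOp_completeSymm_eq 1 (-1)
    (K := m + n) le_rfl (c := fun p q => tau W 0 * bilinearCoeff (affineCoord W) p q) (C := C)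
    fun σ hσ hσ1 x y hx hy => ?_
  rw [one_smul, neg_one_smul, ← sub_eq_add_neg]
  exact hC σ hσ hσ1 x y hx hy

theorem IsAdmissibleFrame.diffOp_neg_one_diffOp_one (hW : IsAdmissibleFrame W w)
    (hw : InBigCell w) (m n : ℕ) :
    diffOp (-1) (completeSymm n) (diffOp 1 (completeSymm m) (tau W)) 0 =
      tau W 0 * bilinearCoeff (affineCoord W) m n := by
  obtain ⟨C, hC⟩ := hW.exists_norm_tau_powVec_sub_sum_le hw (n + m)
  refine (hW.finitelySmooth_tau hw.toInGrassmannian).diffOp_diffOp_completeSymm_eq (-1) 1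
    (K := n + m) le_rfl (c := fun q p => tau W 0 * bilinearCoeff (affineCoord W) p q) (C := C)
    fun σ hσ hσ1 y x hy hx => ?_
  rw [one_smul, neg_one_smul, neg_add_eq_sub, Finset.sum_comm]
  simp only [mul_right_comm _ (y ^ _)]
  exact hC σ hσ hσ1 x y hx hy

end

/-- The antidiagonal sums of the coefficients of `(x - y) ∑ A_{ab} x ^ a y ^ b` telescope. -/
theorem sum_bilinearCoeff_left (A : ℕ → ℕ → ℂ) (b : ℕ) : ∀ a : ℕ,
    ∑ j ∈ Finset.range (b + 1), bilinearCoeff A (a + j + 1) (b - j) = A a b := by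
  induction b with
  | zero => intro a; simp [bilinearCoeff]
  | succ b ih =>
    intro a
    rw [Finset.sum_range_succ']
    have : ∀ j ∈ Finset.range (b + 1), bilinearCoeff A (a + (j + 1) + 1) (b + 1 - (j + 1)) =
        bilinearCoeff A (a + 1 + j + 1) (b - j) := fun j _ => by
      rw [Nat.add_sub_add_right, add_right_comm a 1 j, add_assoc a j 1]
    rw [Finset.sum_congr rfl this, ih (a + 1)]
    simp [bilinearCoeff]

theorem sum_bilinearCoeff_right (A : ℕ → ℕ → ℂ) (a : ℕ) : ∀ b : ℕ,
    ∑ j ∈ Finset.range (a + 1), bilinearCoeff A (a - j) (b + j + 1) = -A a b := by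
  induction a with
  | zero => intro b; simp [bilinearCoeff]
  | succ a ih =>
    intro b
    rw [Finset.sum_range_succ']
    have : ∀ j ∈ Finset.range (a + 1), bilinearCoeff A (a + 1 - (j + 1)) (b + (j + 1) + 1) =
        bilinearCoeff A (a - j) (b + 1 + j + 1) := fun j _ => by
      rw [Nat.add_sub_add_right, add_right_comm b 1 j, add_assoc b j 1]
    rw [Finset.sum_congr rfl this, ih (b + 1)]
    simp [bilinearCoeff]

theorem extend_eq_sum_single (F : Finset ℕ+) (s : F → ℂ) :
    Function.extend Subtype.val s 0 = ⇑(∑ k : F, s k • Finsupp.single (k : ℕ+) (1 : ℂ)) := by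
  ext i
  rw [Finsupp.coe_finsetSum, Finset.sum_apply]
  by_cases hi : i ∈ F
  · have := Subtype.val_injective.extend_apply s 0 (⟨i, hi⟩ : F)
    rw [this, Finset.sum_eq_single (⟨i, hi⟩ : F)]
    · simp
    · intro b _ hb
      have : (b : ℕ+) ≠ i := fun h => hb (Subtype.ext h)
      simp [this]
    · simp
  · rw [Function.extend_apply' _ _ _ (by rintro ⟨a, rfl⟩; exact hi a.2), Finset.sum_eq_zero]
    · rfl
    · intro b _
      have : (b : ℕ+) ≠ i := fun h => hi (h ▸ b.2)
      simp [this]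

end KPTau

theorem mainTheorem9 (w : Submodule ℂ KPTau.L2Circle) (hw : KPTau.InBigCell w)
    (W : KPTau.Hplus →L[ℂ] KPTau.L2Circle) (hW : KPTau.IsAdmissibleFrame W w) :
    (∀ t : ℕ+ → ℂ, KPTau.FlowParam t →
      Tendsto (KPTau.leadingMinor (KPTau.flowPlusBlock W t)) atTop (𝓝 (KPTau.tau W t))) ∧
    (∀ F : Finset ℕ+,
      ContDiff ℂ ∞ (fun s : F → ℂ => KPTau.tau W (Function.extend Subtype.val s 0))) ∧
    KPTau.tau W 0 ≠ 0 ∧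
    ∀ a b : ℕ,
      KPTau.affineCoord W a b =
        (∑ j ∈ Finset.range (b + 1),
          KPTau.diffOp 1 (KPTau.completeSymm (a + j + 1))
            (KPTau.diffOp (-1) (KPTau.completeSymm (b - j)) (KPTau.tau W)) 0) /
          KPTau.tau W 0 ∧
      KPTau.affineCoord W a b =
        (-∑ j ∈ Finset.range (a + 1),
          KPTau.diffOp (-1) (KPTau.completeSymm (b + j + 1))
            (KPTau.diffOp 1 (KPTau.completeSymm (a - j)) (KPTau.tau W)) 0) /
          KPTau.tau W 0 := by
  have h0 : KPTau.tau W 0 ≠ 0 := by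
    rw [KPTau.tau_zero]
    exact hW.infDet_plus_ne_zero hw
  refine ⟨fun t ht => ?_, fun F => ?_, h0, fun a b => ⟨?_, ?_⟩⟩
  · obtain ⟨r, hr, hs⟩ := ht
    exact hW.tendsto_leadingMinor hw.toInGrassmannian ⟨hs, le_rfl⟩ hr
  · simp only [KPTau.extend_eq_sum_single]
    exact hW.contDiff_tau hw.toInGrassmannian _
  · simp only [hW.diffOp_one_diffOp_neg_one hw]
    rw [← Finset.mul_sum, KPTau.sum_bilinearCoeff_left, mul_div_cancel_left₀ _ h0]
  · simp only [hW.diffOp_neg_one_diffOp_one hw]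
    rw [← Finset.mul_sum, KPTau.sum_bilinearCoeff_right, mul_neg, neg_neg,
      mul_div_cancel_left₀ _ h0]
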